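/- Let $n\ge 1$, $t>0$, $x_0\in\mathbb{R}^n$. Let $A_{\rm int}\in\mathbb{R}^{n\times n}$ have ones on the first superdiagonal and zeros elsewhere, let $b_{\rm con}=(0,\dots,0,1)^\top$, and consider the integrator $\dot x=A_{\rm int}x+b_{\rm con}u$, $x(0)=x_0$, with input constraint $u_{\min}(s)\le u(s)\le u_{\max}(s)$ for all $s\in[0,t]$. The range $[u_{\min}(s),u_{\max}(s)]$ is one of the following: (a) it is given by continuous functions $u_{\min}\le u_{\max}$ on $[0,t]$; or (b) it is induced by a controllable system $\dot z=Az+bv$, $z(0)=z_0$, $v\in[v_{\min},v_{\max}]$ with constants $v_{\min}\le v_{\max}$, as follows. Let $q^\top$ be the last row of the inverse of $(b,Ab,\dots,A^{n-1}b)$, let $M$ be the matrix with rows $q^\top,q^\top A,\dots,q^\top A^{n-1}$, let $A_{\rm con}=MAM^{-1}$, and let $c=(c_0,\dots,c_{n-1})^\top$ where $\lambda^n+c_{n-1}\lambda^{n-1}+\dots+c_0$ is the characteristic polynomial of $A$. Then $x_0=Mz_0$ and $$u_{\min}(s)=-\langle c,e^{sA_{\rm con}}Mz_0\rangle+\inf_v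 I_s(v),\qquad u_{\max}(s)=-\langle c,e^{sA_{\rm con}}Mz_0\rangle+\sup_v I_s(v),$$ where $I_s(v)=v(s)-\int_0^s\langle c,e^{(s-\tau)A_{\rm con}}b_{\rm con}\rangle v(\tau)\,d\tau$ and $v$ ranges over the continuous functions $[0,s]\to[v_{\min},v_{\max}]$. Let $\mathcal{X}_t$ be the set of states $x(t)$ reached with measurable inputs $u$ satisfying the constraint, and let $\mathcal{X}^{c}_t$ be the set of those reached with continuous ones. Put $\mathcal{W}_t=\{\sigma\in\mathbb{R}^{n-1}: 0\le\sigma_1\le\dots\le\sigma_{n-1}\le t\}$, $\sigma_0=0$, $\sigma_n=t$, $\mu=(u_{\max}-u_{\min})/2$, $\nu=(u_{\max}+u_{\min})/2$, $$\xi(s)=\Big(\tfrac{s^{n-1}}{(n-1)!},\tfrac{s^{n-2}}{(n-2)!},\dots,s,1\Big)^\top,\quad \chi_k=\sum_{\ell=k}^n\tfrac{t^{\ell-k}}{(\ell-k)!}(x_0)_\ell,\quad \eta_t=\chi+\int_0^t\nu(s)\xi(t-s)\,ds,$$ $$x^{\rm upper}(\sigma)=\eta_t+\sum_{k=1}^{n}(-1)^{k-1}\int_{\sigma_{k-1}}^{\sigma_k}\mu(s)\xi(t-s)\,ds,\qquad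 x^{\rm lower}(\sigma)=\eta_t-\sum_{k=1}^{n}(-1)^{k-1}\int_{\sigma_{k-1}}^{\sigma_k}\mu(s)\xi(t-s)\,ds,$$ and $\pi(\sigma,\lambda)=\lambda x^{\rm upper}(\sigma)+(1-\lambda)x^{\rm lower}(\sigma)$. Then: 1. $\pi$ maps $\mathcal{W}_t\times[0,1]$ into $\mathcal{X}_t$, and $\pi:\mathcal{W}_t\times[0,1]\to\mathcal{X}_t$ is surjective. 2. For continuous inputs: every $x\in\mathcal{X}^c_t$ equals $\pi(\sigma,\lambda)$ for some $(\sigma,\lambda)\in\mathcal{W}_t\times[0,1]$, and $\pi(\mathcal{W}_t\times[0,1])=\overline{\mathcal{X}^c_t}$. 3. For every $\sigma\in\mathcal{W}_t$, the points $x^{\rm upper}(\sigma)$ and $x^{\rm lower}(\sigma)$ lie on the boundary of $\mathcal{X}_t$ and on the boundary of $\mathcal{X}^c_t$, and they are antipodal about $\eta_t$: $x^{\rm lower}(\sigma)-\eta_t=-(x^{\rm upper}(\sigma)-\eta_t)$. -/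

import Mathlib

open Set MeasureTheory
open scoped Matrix Nat

namespace LTIReach

/-! The state dimension is `n = m + 1`; coordinates are indexed by `Fin (m + 1)`. -/

section Integrator

/-- The state matrix of the integrator chain: ones on the first superdiagonal, zeros elsewhere. -/
def Aint (m : ℕ) : Matrix (Fin (m + 1)) (Fin (m + 1)) ℝ :=
  Matrix.of fun i j => if (i : ℕ) + 1 = (j : ℕ) then 1 else 0

/-- The input vector `(0, …, 0, 1)`. -/
def bcon (m : ℕ) : Fin (m + 1) → ℝ :=
  fun i => if i = Fin.last m then 1 else 0

/-- `x` is a classical (differentiable) solution on `[0, t]` of `x' = Aint x + bcon u`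
with `x 0 = x₀`. -/
def IsClassicalTrajectory {m : ℕ} (t : ℝ) (x₀ : Fin (m + 1) → ℝ) (u : ℝ → ℝ)
    (x : ℝ → Fin (m + 1) → ℝ) : Prop :=
  x 0 = x₀ ∧ ∀ s ∈ Icc 0 t,
    HasDerivWithinAt x (Aint m *ᵥ x s + u s • bcon m) (Icc 0 t) s

/-- `x` is a Carathéodory solution on `[0, t]` of `x' = Aint x + bcon u` with `x 0 = x₀`, that is,
a continuous solution of the corresponding integral equation. -/
def IsTrajectory {m : ℕ} (t : ℝ) (x₀ : Fin (m + 1) → ℝ) (u : ℝ → ℝ)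
    (x : ℝ → Fin (m + 1) → ℝ) : Prop :=
  ContinuousOn x (Icc 0 t) ∧ ∀ s ∈ Icc 0 t,
    x s = x₀ + ∫ τ in (0 : ℝ)..s, (Aint m *ᵥ x τ + u τ • bcon m)

/-- States reached at time `t` from `x₀` with continuous inputs satisfying
`umin s ≤ u s ≤ umax s` on `[0, t]`. -/
def contReachSet {m : ℕ} (t : ℝ) (x₀ : Fin (m + 1) → ℝ) (umin umax : ℝ → ℝ) :
    Set (Fin (m + 1) → ℝ) :=
  {y | ∃ (u : ℝ → ℝ) (x : ℝ → Fin (m + 1) → ℝ), ContinuousOn u (Icc 0 t) ∧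
    (∀ s ∈ Icc 0 t, u s ∈ Icc (umin s) (umax s)) ∧ IsClassicalTrajectory t x₀ u x ∧ x t = y}

/-- States reached at time `t` from `x₀` with measurable inputs satisfying
`umin s ≤ u s ≤ umax s` on `[0, t]`. -/
def reachSet {m : ℕ} (t : ℝ) (x₀ : Fin (m + 1) → ℝ) (umin umax : ℝ → ℝ) :
    Set (Fin (m + 1) → ℝ) :=
  {y | ∃ (u : ℝ → ℝ) (x : ℝ → Fin (m + 1) → ℝ), Measurable u ∧
    (∀ s ∈ Icc 0 t, u s ∈ Icc (umin s) (umax s)) ∧ IsTrajectory t x₀ u x ∧ x t = y}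

end Integrator

section Boundary

/-- The Weyl chamber `0 ≤ σ₁ ≤ … ≤ σ_{n-1} ≤ t` in `ℝ^{n-1}`. -/
def weyl (m : ℕ) (t : ℝ) : Set (Fin m → ℝ) :=
  {σ | Monotone σ ∧ ∀ i, σ i ∈ Icc 0 t}

/-- Half width of the input range. -/
noncomputable def mu (umin umax : ℝ → ℝ) (s : ℝ) : ℝ := (umax s - umin s) / 2

/-- Midpoint of the input range. -/
noncomputable def nu (umin umax : ℝ → ℝ) (s : ℝ) : ℝ := (umax s + umin s) / 2

/-- The vector `(s^(n-1)/(n-1)!, s^(n-2)/(n-2)!, …, s, 1)`. -/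
noncomputable def xi (m : ℕ) (s : ℝ) : Fin (m + 1) → ℝ :=
  fun k => s ^ (m - (k : ℕ)) / ((m - (k : ℕ))! : ℝ)

/-- The free motion `χ_k = ∑_{ℓ ≥ k} t^(ℓ-k)/(ℓ-k)! x₀_ℓ`. -/
noncomputable def chi {m : ℕ} (t : ℝ) (x₀ : Fin (m + 1) → ℝ) : Fin (m + 1) → ℝ :=
  fun k => ∑ l : Fin (m + 1),
    if k ≤ l then t ^ ((l : ℕ) - (k : ℕ)) / (((l : ℕ) - (k : ℕ))! : ℝ) * x₀ l else 0

/-- The center `η_t`. -/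
noncomputable def eta {m : ℕ} (t : ℝ) (x₀ : Fin (m + 1) → ℝ) (umin umax : ℝ → ℝ) :
    Fin (m + 1) → ℝ :=
  chi t x₀ + ∫ s in (0 : ℝ)..t, nu umin umax s • xi m (t - s)

/-- The nodes `(σ₀, σ₁, …, σ_n) = (0, σ₁, …, σ_{n-1}, t)`. -/
def nodes {m : ℕ} (t : ℝ) (σ : Fin m → ℝ) : Fin (m + 2) → ℝ :=
  Fin.cons (α := fun _ => ℝ) 0 (Fin.snoc (α := fun _ => ℝ) σ t)

/-- The alternating sum `∫_{0}^{σ₁} - ∫_{σ₁}^{σ₂} + … + (-1)^(n-1) ∫_{σ_{n-1}}^{t}` of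
`μ(s) ξ(t - s) ds`. -/
noncomputable def alternating {m : ℕ} (t : ℝ) (umin umax : ℝ → ℝ) (σ : Fin m → ℝ) :
    Fin (m + 1) → ℝ :=
  ∑ k : Fin (m + 1), (-1 : ℝ) ^ (k : ℕ) •
    ∫ s in (nodes t σ k.castSucc)..(nodes t σ k.succ), mu umin umax s • xi m (t - s)

noncomputable def xUpper {m : ℕ} (t : ℝ) (x₀ : Fin (m + 1) → ℝ) (umin umax : ℝ → ℝ)
    (σ : Fin m → ℝ) : Fin (m + 1) → ℝ :=
  eta t x₀ umin umax + alternating t umin umax σ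

noncomputable def xLower {m : ℕ} (t : ℝ) (x₀ : Fin (m + 1) → ℝ) (umin umax : ℝ → ℝ)
    (σ : Fin m → ℝ) : Fin (m + 1) → ℝ :=
  eta t x₀ umin umax - alternating t umin umax σ

/-- The map `π(σ, r) = r x^upper(σ) + (1 - r) x^lower(σ)`. -/
noncomputable def piMap {m : ℕ} (t : ℝ) (x₀ : Fin (m + 1) → ℝ) (umin umax : ℝ → ℝ)
    (p : (Fin m → ℝ) × ℝ) : Fin (m + 1) → ℝ :=
  p.2 • xUpper t x₀ umin umax p.1 + (1 - p.2) • xLower t x₀ umin umax p.1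

end Boundary

section LTI

/-- The controllability matrix `(b, A b, …, A^(n-1) b)`. -/
def ctrbMatrix {m : ℕ} (A : Matrix (Fin (m + 1)) (Fin (m + 1)) ℝ) (b : Fin (m + 1) → ℝ) :
    Matrix (Fin (m + 1)) (Fin (m + 1)) ℝ :=
  Matrix.of fun i j => (A ^ (j : ℕ) *ᵥ b) i

/-- The pair `(A, b)` is controllable: the controllability matrix has full rank. -/
def IsControllable {m : ℕ} (A : Matrix (Fin (m + 1)) (Fin (m + 1)) ℝ)
    (b : Fin (m + 1) → ℝ) : Prop :=
  (ctrbMatrix A b).rank = m + 1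

/-- The matrix with rows `q, q A, …, q A^(n-1)`, where `q` is the last row of the inverse of the
controllability matrix. -/
noncomputable def Mmat {m : ℕ} (A : Matrix (Fin (m + 1)) (Fin (m + 1)) ℝ)
    (b : Fin (m + 1) → ℝ) : Matrix (Fin (m + 1)) (Fin (m + 1)) ℝ :=
  Matrix.of fun i => (ctrbMatrix A b)⁻¹ (Fin.last m) ᵥ* A ^ (i : ℕ)

/-- The state matrix in controllable canonical form. -/
noncomputable def Acon {m : ℕ} (A : Matrix (Fin (m + 1)) (Fin (m + 1)) ℝ)
    (b : Fin (m + 1) → ℝ) : Matrix (Fin (m + 1)) (Fin (m + 1)) ℝ :=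
  Mmat A b * A * (Mmat A b)⁻¹

/-- The coefficients `c₀, …, c_{n-1}` of the monic characteristic polynomial of `A`. -/
noncomputable def cvec {m : ℕ} (A : Matrix (Fin (m + 1)) (Fin (m + 1)) ℝ) : Fin (m + 1) → ℝ :=
  fun i => A.charpoly.coeff (i : ℕ)

/-- The kernel `f(τ) = ⟨c, exp((s - τ) Acon) bcon⟩`. -/
noncomputable def fker {m : ℕ} (A : Matrix (Fin (m + 1)) (Fin (m + 1)) ℝ)
    (b : Fin (m + 1) → ℝ) (s τ : ℝ) : ℝ :=
  cvec A ⬝ᵥ (NormedSpace.exp ((s - τ) • Acon A b) *ᵥ bcon m)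

/-- The functional `I(v) = v(s) - ∫₀ˢ f(τ) v(τ) dτ`. -/
noncomputable def Ifun {m : ℕ} (A : Matrix (Fin (m + 1)) (Fin (m + 1)) ℝ)
    (b : Fin (m + 1) → ℝ) (s : ℝ) (v : ℝ → ℝ) : ℝ :=
  v s - ∫ τ in (0 : ℝ)..s, fker A b s τ * v τ

/-- Continuous inputs on `[0, s]` with values in `[vmin, vmax]`. -/
def contInputs (s vmin vmax : ℝ) : Set (ℝ → ℝ) :=
  {v | ContinuousOn v (Icc 0 s) ∧ ∀ τ ∈ Icc 0 s, v τ ∈ Icc vmin vmax}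

noncomputable def Imin {m : ℕ} (A : Matrix (Fin (m + 1)) (Fin (m + 1)) ℝ)
    (b : Fin (m + 1) → ℝ) (vmin vmax s : ℝ) : ℝ :=
  sInf (Ifun A b s '' contInputs s vmin vmax)

noncomputable def Imax {m : ℕ} (A : Matrix (Fin (m + 1)) (Fin (m + 1)) ℝ)
    (b : Fin (m + 1) → ℝ) (vmin vmax s : ℝ) : ℝ :=
  sSup (Ifun A b s '' contInputs s vmin vmax)

/-- The lower end of the induced time-varying input range. -/
noncomputable def uMinLTI {m : ℕ} (A : Matrix (Fin (m + 1)) (Fin (m + 1)) ℝ)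
    (b z₀ : Fin (m + 1) → ℝ) (vmin vmax s : ℝ) : ℝ :=
  -(cvec A ⬝ᵥ (NormedSpace.exp (s • Acon A b) *ᵥ (Mmat A b *ᵥ z₀))) + Imin A b vmin vmax s

/-- The upper end of the induced time-varying input range. -/
noncomputable def uMaxLTI {m : ℕ} (A : Matrix (Fin (m + 1)) (Fin (m + 1)) ℝ)
    (b z₀ : Fin (m + 1) → ℝ) (vmin vmax s : ℝ) : ℝ :=
  -(cvec A ⬝ᵥ (NormedSpace.exp (s • Acon A b) *ᵥ (Mmat A b *ᵥ z₀))) + Imax A b vmin vmax s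

/-- The initial state and the input range are those induced by a controllable system
`z' = A z + b v`, `z 0 = z₀`, `v ∈ [vmin, vmax]`. -/
def IsInducedByLTI {m : ℕ} (x₀ : Fin (m + 1) → ℝ) (umin umax : ℝ → ℝ) : Prop :=
  ∃ (A : Matrix (Fin (m + 1)) (Fin (m + 1)) ℝ) (b z₀ : Fin (m + 1) → ℝ) (vmin vmax : ℝ),
    IsControllable A b ∧ vmin ≤ vmax ∧ x₀ = Mmat A b *ᵥ z₀ ∧
    umin = uMinLTI A b z₀ vmin vmax ∧ umax = uMaxLTI A b z₀ vmin vmax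

/-- The input range is given by arbitrary continuous curves `umin ≤ umax` on `[0, t]`. -/
def IsContinuousRange (t : ℝ) (umin umax : ℝ → ℝ) : Prop :=
  ContinuousOn umin (Icc 0 t) ∧ ContinuousOn umax (Icc 0 t) ∧ ∀ s ∈ Icc 0 t, umin s ≤ umax s

end LTI

end LTIReach

namespace LTIReach

/-! ### Variation of constants for the integrator chain -/

section Trajectories

open Filter Topology

/-! Variation of constants gives x(t) = χ + ∫ u(s) ξ(t-s) ds. Writing u = ν + wμ with |w| ≤ 1 turns
the reachable set into η_t + Z, where Z = {∫ w μ ξ(t-·)} is convex and contains 0 (`reachSet_eq`).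

A nonzero linear functional evaluated on ξ(t-s) is a nonzero polynomial p(s) of degree at most m =
n-1, and every such polynomial arises this way. The functional is maximized over Z by w = sign p,
which has at most n-1 switches. Since p has finitely many zeros, the maximizing w is determined
almost everywhere where μ > 0, so a point of the closure of Z on a supporting hyperplane must be ± a
switching point (`eq_switching_of_isMax`). For nonzero x in Z, the last multiple Rx lying in the
closure of Z is such a point, and R ≥ 1; hence x is a multiple of modulus at most 1 of a switching
point, which is surjectivity of π (`exists_switching_of_mem_zonoid`).

Conversely, any switching times σ give the sign pattern of the polynomial ∏ (σ_i - s), so every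
switching point and its antipode maximize a nonzero functional and lie on the boundary
(`exists_functional_isMax`).

Continuous inputs are L¹-dense among the admissible ones, so they reach a dense part of the same
set, and the image of π is compact (`image_piMap_eq_closure`). The range induced by a controllable
system is continuous because its infimum and supremum can be computed explicitly, so that case
reduces to the other one (`IsInducedByLTI.isContinuousRange`). -/

theorem hasDerivAt_sub_pow_div_factorial (t s : ℝ) (j : ℕ) :
    HasDerivAt (fun r : ℝ => (t - r) ^ (j + 1) / ((j + 1)! : ℝ)) (-((t - s) ^ j / (j ! : ℝ))) s := by
  have h := (((hasDerivAt_id s).const_sub t).pow (j + 1)).div_const ((j + 1)! : ℝ)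
  refine h.congr_deriv ?_
  have h1 : ((j : ℝ) + 1) ≠ 0 := by positivity
  have h2 : (j ! : ℝ) ≠ 0 := by positivity
  simp only [Nat.factorial_succ, Nat.cast_mul, Nat.cast_add, Nat.cast_one, id, Nat.add_sub_cancel]
  field_simp

/-- The Taylor sum of a chain `y₀' = y₁, y₁' = y₂, …` telescopes under differentiation. -/
theorem hasDerivAt_taylor_sum {t s : ℝ} {y : ℕ → ℝ → ℝ} (N : ℕ)
    (hy : ∀ j ≤ N, HasDerivAt (y j) (y (j + 1) s) s) :
    HasDerivAt (fun r => ∑ j ∈ Finset.range (N + 1), (t - r) ^ j / (j ! : ℝ) * y j r)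
      ((t - s) ^ N / (N ! : ℝ) * y (N + 1) s) s := by
  induction N with
  | zero => simpa using hy 0 le_rfl
  | succ N ih =>
    have h1 := ih fun j hj => hy j (hj.trans N.le_succ)
    have h2 := (hasDerivAt_sub_pow_div_factorial t s N).mul (hy (N + 1) le_rfl)
    simp_rw [Finset.sum_range_succ _ (N + 1)]
    refine (h1.add h2).congr_deriv ?_
    ring

/-- The sum of (t-r)^j/j! · y_j(r) is absolutely continuous in r, equals y_0(t) at r = t and the
Taylor sum at r = 0, and its derivative telescopes almost everywhere to the last term. Absolute
continuity is needed because the top of the chain is an input that is only integrable. The formula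
`hy` holds for all real s, so derivatives are two-sided, whereas `g` has to match the next function
only on [0,t]. -/
theorem taylor_sum_eq_of_chain {t : ℝ} (ht : 0 ≤ t) {y g : ℕ → ℝ → ℝ} (N : ℕ)
    (hint : ∀ j ≤ N, IntervalIntegrable (g j) volume 0 t)
    (hg : ∀ j ≤ N, ∀ s ∈ Icc 0 t, g j s = y (j + 1) s)
    (hy : ∀ j ≤ N, ∀ s, y j s = y j 0 + ∫ τ in (0 : ℝ)..s, g j τ) :
    y 0 t = (∑ j ∈ Finset.range (N + 1), t ^ j / (j ! : ℝ) * y j 0)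
      + ∫ s in (0 : ℝ)..t, (t - s) ^ N / (N ! : ℝ) * y (N + 1) s := by
  set G : ℝ → ℝ := fun r => ∑ j ∈ Finset.range (N + 1), (t - r) ^ j / (j ! : ℝ) * y j r with hG
  have hyac : ∀ j ≤ N, AbsolutelyContinuousOnInterval (y j) 0 t := by
    intro j hj
    have h := (hint j hj).absolutelyContinuousOnInterval_intervalIntegral (c := 0) (by simp)
    have hc : AbsolutelyContinuousOnInterval (fun _ : ℝ => y j 0) 0 t :=
      contDiffOn_const.absolutelyContinuousOnInterval
    rw [show y j = fun s => y j 0 + ∫ τ in (0 : ℝ)..s, g j τ from funext (hy j hj)]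
    exact hc.fun_add h
  have hGac : AbsolutelyContinuousOnInterval G 0 t := by
    have : ∀ M ≤ N + 1, AbsolutelyContinuousOnInterval
        (fun r => ∑ j ∈ Finset.range M, (t - r) ^ j / (j ! : ℝ) * y j r) 0 t := by
      intro M
      induction M with
      | zero =>
        intro _
        simpa using (contDiffOn_const (c := (0 : ℝ))).absolutelyContinuousOnInterval
      | succ M ih =>
        intro hM
        simp_rw [Finset.sum_range_succ]
        refine (ih (by omega)).fun_add (AbsolutelyContinuousOnInterval.fun_mul ?_
          (hyac M (by omega)))
        apply ContDiffOn.absolutelyContinuousOnInterval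
        fun_prop
    exact this _ le_rfl
  have hder : ∀ᵐ s, s ∈ uIoc 0 t → deriv G s = (t - s) ^ N / (N ! : ℝ) * y (N + 1) s := by
    have : ∀ᵐ s, ∀ j ∈ Finset.range (N + 1), s ∈ uIcc 0 t →
        HasDerivAt (y j) (y (j + 1) s) s := by
      rw [Finset.eventually_all]
      intro j hj
      have hj' : j ≤ N := by simpa [Nat.lt_succ_iff] using hj
      filter_upwards [(hint j hj').ae_hasDerivAt_integral] with s hs hst
      have h := (hs hst 0 (by simp)).const_add (y j 0)
      rw [← hg j hj' s (by rwa [← uIcc_of_le ht])]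
      rwa [← show y j = fun s => y j 0 + ∫ τ in (0 : ℝ)..s, g j τ from funext (hy j hj')] at h
    filter_upwards [this] with s hs hst
    exact (hasDerivAt_taylor_sum N fun j hj => hs j (by simpa [Nat.lt_succ_iff] using hj)
      (uIoc_subset_uIcc hst)).deriv
  have hGt : G t = y 0 t := by
    simp only [hG, sub_self]
    rw [Finset.sum_eq_single 0]
    · simp
    · intro j _ hj; simp [hj]
    · simp
  have hG0 : G 0 = ∑ j ∈ Finset.range (N + 1), t ^ j / (j ! : ℝ) * y j 0 := by simp [hG]
  have h1 := hGac.integral_deriv_eq_sub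
  rw [intervalIntegral.integral_congr_ae hder, hGt, hG0] at h1
  linarith

theorem Aint_mulVec_apply {m : ℕ} (x : Fin (m + 1) → ℝ) (i : Fin (m + 1)) :
    (Aint m *ᵥ x) i = if h : (i : ℕ) + 1 < m + 1 then x ⟨i + 1, h⟩ else 0 := by
  simp only [Matrix.mulVec, dotProduct, Aint, Matrix.of_apply, ite_mul, one_mul, zero_mul]
  split_ifs with h
  · rw [Finset.sum_eq_single ⟨i + 1, h⟩]
    · simp
    · intro j _ hj
      rw [if_neg]
      intro hij
      exact hj (Fin.ext hij.symm)
    · simp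
  · refine Finset.sum_eq_zero fun j _ => if_neg ?_
    have := j.isLt
    omega

theorem integrator_rhs_apply {m : ℕ} (x : Fin (m + 1) → ℝ) (c : ℝ) (i : Fin (m + 1)) :
    (Aint m *ᵥ x + c • bcon m) i = if h : (i : ℕ) + 1 < m + 1 then x ⟨i + 1, h⟩ else c := by
  simp only [Pi.add_apply, Aint_mulVec_apply, Pi.smul_apply, bcon, smul_eq_mul]
  have hi := i.isLt
  split_ifs with h1 h2 h2
  · rw [h2] at h1; simp at h1
  · simp
  · simp
  · exact absurd (Fin.ext (by simp; omega)) h2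

theorem continuous_xi (m : ℕ) : Continuous (xi m) := by
  unfold xi
  fun_prop

theorem integral_apply {m : ℕ} {a b : ℝ} {g : ℝ → Fin (m + 1) → ℝ}
    (hg : IntervalIntegrable g volume a b) (i : Fin (m + 1)) :
    (∫ s in a..b, g s) i = ∫ s in a..b, (g s) i :=
  ((ContinuousLinearMap.proj i : (Fin (m + 1) → ℝ) →L[ℝ] ℝ).intervalIntegral_comp_comm
    hg).symm

theorem intervalIntegrable_pi {m : ℕ} {a b : ℝ} {g : ℝ → Fin (m + 1) → ℝ}
    (hg : ∀ i, IntervalIntegrable (fun s => g s i) volume a b) :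
    IntervalIntegrable g volume a b := by
  simp only [intervalIntegrable_iff, IntegrableOn] at hg ⊢
  exact Integrable.of_eval hg

theorem chi_apply_eq_sum_range {m : ℕ} (t : ℝ) (x₀ : Fin (m + 1) → ℝ) (k : Fin (m + 1)) (y : ℕ → ℝ)
    (hy : ∀ l : Fin (m + 1), k ≤ l → y (l - k) = x₀ l) :
    chi t x₀ k = ∑ j ∈ Finset.range (m - k + 1), t ^ j / (j ! : ℝ) * y j := by
  have h1 : chi t x₀ k = ∑ l : Fin (m + 1), (fun l : ℕ => if (k : ℕ) ≤ l then
      t ^ (l - (k : ℕ)) / ((l - (k : ℕ))! : ℝ) * y (l - k) else 0) l := by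
    unfold chi
    refine Finset.sum_congr rfl fun l _ => ?_
    by_cases h : k ≤ l
    · simp [h, hy l h]
    · have h' : ¬ (k : ℕ) ≤ l := h
      simp [h]
  rw [h1, Fin.sum_univ_eq_sum_range (fun l : ℕ => if (k : ℕ) ≤ l then
      t ^ (l - (k : ℕ)) / ((l - (k : ℕ))! : ℝ) * y (l - k) else 0), ← Finset.sum_filter]
  have h2 : (Finset.range (m + 1)).filter (fun l => (k : ℕ) ≤ l) = Finset.Ico (k : ℕ) (m + 1) := by
    ext; simp; omega
  rw [h2, Finset.sum_Ico_eq_sum_range]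
  have hk := k.isLt
  have h3 : m + 1 - (k : ℕ) = m - k + 1 := by omega
  rw [h3]
  simp

/-- Variation of constants for the integrator. -/
theorem IsTrajectory.apply_eq {m : ℕ} {t : ℝ} (ht : 0 ≤ t) {x₀ : Fin (m + 1) → ℝ} {u : ℝ → ℝ}
    {x : ℝ → Fin (m + 1) → ℝ} (hu : IntervalIntegrable u volume 0 t)
    (h : IsTrajectory t x₀ u x) :
    x t = chi t x₀ + ∫ s in (0 : ℝ)..t, u s • xi m (t - s) := by
  obtain ⟨hc, hx⟩ := h
  have hcomp : ∀ i, IntervalIntegrable (fun s => x s i) volume 0 t := fun i =>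
    ContinuousOn.intervalIntegrable_of_Icc ht ((continuous_apply i).comp_continuousOn hc)
  have hrhs : ∀ i, IntervalIntegrable (fun s => (Aint m *ᵥ x s + u s • bcon m) i) volume 0 t := by
    intro i
    simp_rw [integrator_rhs_apply]
    split_ifs with h
    · exact hcomp _
    · exact hu
  have hrhs' := intervalIntegrable_pi hrhs
  have hxi : IntervalIntegrable (fun s => u s • xi m (t - s)) volume 0 t := by
    refine hu.smul_continuousOn (Continuous.continuousOn ?_)
    exact (continuous_xi m).comp (continuous_const.sub continuous_id)
  -- the chain of coordinates, extended by the integral formula to all times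
  set X : ℕ → ℝ → ℝ := fun l s => if h : l < m + 1 then
    x₀ ⟨l, h⟩ + ∫ τ in (0 : ℝ)..s, (Aint m *ᵥ x τ + u τ • bcon m) ⟨l, h⟩ else u s with hX
  have hXx : ∀ (l : ℕ) (hl : l < m + 1), ∀ s ∈ Icc 0 t, X l s = x s ⟨l, hl⟩ := by
    intro l hl s hs
    simp only [hX, dif_pos hl]
    rw [hx s hs, Pi.add_apply, integral_apply (hrhs'.mono_set _)]
    rw [uIcc_of_le hs.1, uIcc_of_le ht]
    exact Icc_subset_Icc le_rfl hs.2
  ext k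
  have hk := k.isLt
  set g : ℕ → ℝ → ℝ := fun j s => if h : (k : ℕ) + j < m + 1 then
    (Aint m *ᵥ x s + u s • bcon m) ⟨k + j, h⟩ else 0 with hg
  -- The chain starts at coordinate k; its entry number m-k+1 is `X (m + 1)`, which is the input
  -- `u`.
  have key := taylor_sum_eq_of_chain ht (y := fun j => X (k + j)) (g := g) (m - k) ?_ ?_ ?_
  · have hku : (k : ℕ) + (m - k + 1) = m + 1 := by omega
    rw [Pi.add_apply, integral_apply hxi,
      chi_apply_eq_sum_range t x₀ k (fun j => X (k + j) 0) ?_, ← hXx k hk t ⟨ht, le_rfl⟩]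
    · simp only [add_zero, hku] at key
      rw [key]
      congr 1
      refine intervalIntegral.integral_congr fun s _ => ?_
      simp [hX, xi, mul_comm]
    · intro l hl
      have : (k : ℕ) + (l - k) = l := by have : (k : ℕ) ≤ l := hl; omega
      have hlm : m + 1 > l := l.isLt
      simp only [hX, this, dif_pos hlm, intervalIntegral.integral_same, add_zero]
  · intro j hj
    have : (k : ℕ) + j < m + 1 := by omega
    simp only [hg, dif_pos this]
    exact hrhs _
  · intro j hj s hs
    have h1 : (k : ℕ) + j < m + 1 := by omega
    simp only [hg, dif_pos h1, integrator_rhs_apply, ← add_assoc]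
    split_ifs with h
    · exact (hXx _ h s hs).symm
    · simp only [hX, dif_neg h]
  · intro j hj s
    have h1 : (k : ℕ) + j < m + 1 := by omega
    simp only [hX, hg, dif_pos h1, intervalIntegral.integral_same, add_zero]

/-- The chain of iterated primitives solving the integrator, counted from the input upwards. -/
noncomputable def primitiveChain (u : ℝ → ℝ) (c : ℕ → ℝ) : ℕ → ℝ → ℝ
  | 0 => u
  | i + 1 => fun s => c i + ∫ τ in (0 : ℝ)..s, primitiveChain u c i τ

theorem continuous_primitiveChain_succ {u : ℝ → ℝ}
    (hu : ∀ a b, IntervalIntegrable u volume a b) (c : ℕ → ℝ) (i : ℕ) :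
    Continuous (primitiveChain u c (i + 1)) := by
  induction i with
  | zero => exact continuous_const.add (intervalIntegral.continuous_primitive hu 0)
  | succ i ih =>
    exact continuous_const.add
      (intervalIntegral.continuous_primitive (fun a b => ih.intervalIntegrable a b) 0)

/-- The state trajectory of the integrator with input `u`. -/
noncomputable def integratorState {m : ℕ} (x₀ : Fin (m + 1) → ℝ) (u : ℝ → ℝ) (s : ℝ) :
    Fin (m + 1) → ℝ :=
  fun l => primitiveChain u (fun i => x₀ (Fin.ofNat (m + 1) (m - i))) (m - l + 1) s

theorem integratorState_rhs_apply {m : ℕ} (x₀ : Fin (m + 1) → ℝ) (u : ℝ → ℝ) (s : ℝ)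
    (l : Fin (m + 1)) :
    (Aint m *ᵥ integratorState x₀ u s + u s • bcon m) l =
      primitiveChain u (fun i => x₀ (Fin.ofNat (m + 1) (m - i))) (m - l) s := by
  rw [integrator_rhs_apply]
  have hl := l.isLt
  split_ifs with h
  · simp only [integratorState]
    congr 2
    omega
  · have : m - (l : ℕ) = 0 := by omega
    rw [this]
    rfl

theorem integratorState_apply {m : ℕ} (x₀ : Fin (m + 1) → ℝ) (u : ℝ → ℝ) (s : ℝ)
    (l : Fin (m + 1)) :
    integratorState x₀ u s l =
      x₀ l + ∫ τ in (0 : ℝ)..s, (Aint m *ᵥ integratorState x₀ u τ + u τ • bcon m) l := by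
  simp_rw [integratorState_rhs_apply]
  have hl := l.isLt
  have h1 : Fin.ofNat (m + 1) (m - (m - (l : ℕ))) = l := by
    ext
    simp only [Fin.val_ofNat]
    rw [Nat.mod_eq_of_lt (by omega)]
    omega
  simp only [integratorState, primitiveChain, h1]

theorem isTrajectory_integratorState {m : ℕ} (t : ℝ) (x₀ : Fin (m + 1) → ℝ) {u : ℝ → ℝ}
    (hu : ∀ a b, IntervalIntegrable u volume a b) :
    IsTrajectory t x₀ u (integratorState x₀ u) := by
  refine ⟨(continuous_pi fun l => continuous_primitiveChain_succ hu _ _).continuousOn,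
    fun s _ => ?_⟩
  ext l
  rw [Pi.add_apply, integral_apply]
  · exact integratorState_apply x₀ u s l
  · refine intervalIntegrable_pi fun i => ?_
    simp_rw [integratorState_rhs_apply]
    cases m - (i : ℕ) with
    | zero => exact hu _ _
    | succ n => exact (continuous_primitiveChain_succ hu _ n).intervalIntegrable _ _

theorem isClassicalTrajectory_integratorState {m : ℕ} (t : ℝ) (x₀ : Fin (m + 1) → ℝ) {u : ℝ → ℝ}
    (hu : Continuous u) :
    IsClassicalTrajectory t x₀ u (integratorState x₀ u) := by
  have hu' := fun a b => hu.intervalIntegrable (μ := volume) a b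
  refine ⟨?_, fun s _ => HasDerivAt.hasDerivWithinAt (hasDerivAt_pi.2 fun l => ?_)⟩
  · ext l
    rw [integratorState_apply]
    simp
  · have hc : Continuous (primitiveChain u (fun i => x₀ (Fin.ofNat (m + 1) (m - i))) (m - l)) := by
      cases m - (l : ℕ) with
      | zero => exact hu
      | succ n => exact continuous_primitiveChain_succ hu' _ n
    rw [integratorState_rhs_apply]
    have := (intervalIntegral.integral_hasDerivAt_right (hc.intervalIntegrable 0 s)
      (hc.stronglyMeasurableAtFilter _ _) hc.continuousAt).const_add (x₀ l)
    refine this.congr_of_eventuallyEq (Eventually.of_forall fun r => ?_)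
    beta_reduce
    rw [integratorState_apply]
    simp_rw [integratorState_rhs_apply]

theorem IsClassicalTrajectory.isTrajectory {m : ℕ} {t : ℝ} {x₀ : Fin (m + 1) → ℝ} {u : ℝ → ℝ}
    {x : ℝ → Fin (m + 1) → ℝ} (hu : ContinuousOn u (Icc 0 t))
    (h : IsClassicalTrajectory t x₀ u x) : IsTrajectory t x₀ u x := by
  obtain ⟨h0, hd⟩ := h
  have hc : ContinuousOn x (Icc 0 t) := fun s hs => (hd s hs).continuousWithinAt
  refine ⟨hc, fun s hs => ?_⟩
  have hsub : Icc 0 s ⊆ Icc 0 t := Icc_subset_Icc le_rfl hs.2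
  have hr : ContinuousOn (fun τ => Aint m *ᵥ x τ + u τ • bcon m) (Icc 0 t) :=
    (((Matrix.mulVecLin (Aint m)).continuous_of_finiteDimensional).comp_continuousOn hc).add
      (hu.smul continuousOn_const)
  have := intervalIntegral.integral_eq_sub_of_hasDeriv_right (a := 0) (b := s) (f := x)
    (f' := fun τ => Aint m *ᵥ x τ + u τ • bcon m)
    (by rw [uIcc_of_le hs.1]; exact hc.mono hsub) ?_
    (ContinuousOn.intervalIntegrable_of_Icc hs.1 (hr.mono hsub))
  · rw [this, h0]
    simp
  · intro τ hτ
    rw [min_eq_left hs.1, max_eq_right hs.1] at hτ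
    refine (hd τ (hsub ⟨hτ.1.le, hτ.2.le⟩)).mono_of_mem_nhdsWithin ?_
    exact mem_nhdsWithin_of_mem_nhds (Icc_mem_nhds hτ.1 (hτ.2.trans_le hs.2))

end Trajectories

end LTIReach
namespace LTIReach

/-! ### Switching controls and signs of polynomials -/

section SwitchingControls

/-- The switching control of modulus one that starts at `1` and changes sign at each `σ i`. -/
noncomputable def bang {m : ℕ} (σ : Fin m → ℝ) (s : ℝ) : ℝ :=
  ∏ i, if s < σ i then (1 : ℝ) else -1

theorem measurable_bang {m : ℕ} (σ : Fin m → ℝ) : Measurable (bang σ) := by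
  unfold bang
  refine Finset.measurable_fun_prod _ fun i _ => ?_
  exact Measurable.ite measurableSet_Iio measurable_const measurable_const

theorem bang_sq {m : ℕ} (σ : Fin m → ℝ) (s : ℝ) : bang σ s * bang σ s = 1 := by
  unfold bang
  rw [← Finset.prod_mul_distrib]
  refine Finset.prod_eq_one fun i _ => ?_
  split_ifs <;> norm_num

theorem abs_bang {m : ℕ} (σ : Fin m → ℝ) (s : ℝ) : |bang σ s| = 1 := by
  have := bang_sq σ s
  rw [← abs_mul_abs_self] at this
  nlinarith [abs_nonneg (bang σ s)]

theorem bang_comp_perm {m : ℕ} (σ : Fin m → ℝ) (e : Equiv.Perm (Fin m)) :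
    bang (σ ∘ e) = bang σ := by
  ext s
  exact Equiv.prod_comp e fun i => if s < σ i then (1 : ℝ) else -1

theorem nodes_zero {m : ℕ} (t : ℝ) (σ : Fin m → ℝ) : nodes t σ 0 = 0 := rfl

theorem nodes_succ {m : ℕ} (t : ℝ) (σ : Fin m → ℝ) (i : Fin m) :
    nodes t σ i.succ.castSucc = σ i := by
  rw [← Fin.succ_castSucc, nodes, Fin.cons_succ, Fin.snoc_castSucc]

theorem nodes_last {m : ℕ} (t : ℝ) (σ : Fin m → ℝ) : nodes t σ (Fin.last (m + 1)) = t := by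
  rw [← Fin.succ_last, nodes, Fin.cons_succ, Fin.snoc_last]

theorem monotone_nodes {m : ℕ} {t : ℝ} (ht : 0 ≤ t) {σ : Fin m → ℝ} (hσ : σ ∈ weyl m t) :
    Monotone (nodes t σ) := by
  rw [Fin.monotone_iff_le_succ]
  intro i
  induction i using Fin.cases with
  | zero =>
    rw [Fin.castSucc_zero, nodes_zero]
    cases m with
    | zero => exact ht
    | succ m =>
      have : nodes t σ (Fin.succ 0) = σ 0 := nodes_succ t σ 0
      rw [this]
      exact (hσ.2 0).1
  | succ i =>
    rw [nodes_succ]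
    by_cases h : (i : ℕ) + 1 < m
    · have h1 : i.succ.succ = (⟨i + 1, h⟩ : Fin m).succ.castSucc := rfl
      rw [h1, nodes_succ]
      exact hσ.1 (Fin.le_def.2 (Nat.le_succ _))
    · have h1 : i.succ.succ = Fin.last (m + 1) := by
        ext
        have := i.isLt
        simp
        omega
      rw [h1, nodes_last]
      exact (hσ.2 _).2

theorem nodes_mem_Icc {m : ℕ} {t : ℝ} (ht : 0 ≤ t) {σ : Fin m → ℝ} (hσ : σ ∈ weyl m t)
    (i : Fin (m + 2)) : nodes t σ i ∈ Icc 0 t := by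
  constructor
  · rw [← nodes_zero t σ]
    exact monotone_nodes ht hσ (Fin.zero_le i)
  · conv_rhs => rw [← nodes_last t σ]
    exact monotone_nodes ht hσ (Fin.le_last i)

/-- Past the node number k, exactly the factors with index below k have changed sign. -/
theorem bang_eq_of_mem_Ioo {m : ℕ} {t : ℝ} (ht : 0 ≤ t) {σ : Fin m → ℝ} (hσ : σ ∈ weyl m t)
    (k : Fin (m + 1)) {s : ℝ} (hs : s ∈ Ioo (nodes t σ k.castSucc) (nodes t σ k.succ)) :
    bang σ s = (-1) ^ (k : ℕ) := by
  have hmono := monotone_nodes ht hσ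
  have h : ∀ i : Fin m, (if s < σ i then (1 : ℝ) else -1) = if (i : ℕ) < k then -1 else 1 := by
    intro i
    by_cases hik : (i : ℕ) < k
    · rw [if_pos hik, if_neg]
      rw [← nodes_succ t σ i, not_lt]
      refine (hmono ?_).trans hs.1.le
      rw [Fin.le_def]
      simpa using hik
    · rw [if_neg hik, if_pos]
      rw [← nodes_succ t σ i]
      refine hs.2.trans_le (hmono ?_)
      rw [Fin.le_def]
      simpa using hik
  unfold bang
  simp_rw [h]
  rw [Finset.prod_ite]
  simp only [Finset.prod_const, one_pow, mul_one]
  congr 1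
  rw [Fin.card_filter_val_lt]
  have := k.isLt
  omega

variable {E : Type*} [NormedAddCommGroup E] [NormedSpace ℝ E]

theorem intervalIntegrable_smul_of_abs_le {a b : ℝ} {w : ℝ → ℝ} {g : ℝ → E} {C : ℝ}
    (hw : Measurable w) (hb : ∀ s, |w s| ≤ C) (hg : IntervalIntegrable g volume a b) :
    IntervalIntegrable (fun s => w s • g s) volume a b := by
  rw [intervalIntegrable_iff] at hg ⊢
  exact hg.bdd_smul C hw.aestronglyMeasurable (Filter.Eventually.of_forall hb)

/-- The nodes form a null set and coinciding nodes bound empty pieces, so the alternating sum is a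
single integral against `bang σ`. -/
theorem sum_integral_nodes {m : ℕ} {t : ℝ} (ht : 0 ≤ t) {σ : Fin m → ℝ} (hσ : σ ∈ weyl m t)
    {g : ℝ → E} (hg : IntervalIntegrable g volume 0 t) :
    ∑ k : Fin (m + 1), (-1 : ℝ) ^ (k : ℕ) •
      ∫ s in (nodes t σ k.castSucc)..(nodes t σ k.succ), g s = ∫ s in (0 : ℝ)..t, bang σ s • g s := by
  have hint : IntervalIntegrable (fun s => bang σ s • g s) volume 0 t :=
    intervalIntegrable_smul_of_abs_le (measurable_bang σ) (fun s => (abs_bang σ s).le) hg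
  set a : ℕ → ℝ := fun k => nodes t σ (Fin.ofNat (m + 2) k) with ha
  have h0 : a 0 = 0 := rfl
  have ht' : a (m + 1) = t := by
    have : Fin.ofNat (m + 2) (m + 1) = Fin.last (m + 1) := by ext; simp
    rw [ha]; simp only [this]; exact nodes_last t σ
  have hsum := intervalIntegral.sum_integral_adjacent_intervals (a := a) (n := m + 1)
    (f := fun s => bang σ s • g s) (μ := volume) fun k _ => hint.mono_set ?_
  · rw [h0, ht'] at hsum
    rw [← hsum, Finset.sum_range]
    refine Finset.sum_congr rfl fun k _ => ?_
    have h1 : a k = nodes t σ k.castSucc := by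
      simp only [ha]; congr 1; ext; simp
    have h2 : a (k + 1) = nodes t σ k.succ := by
      simp only [ha]; congr 1; ext; simp; omega
    rw [h1, h2, ← intervalIntegral.integral_smul]
    have hle : nodes t σ k.castSucc ≤ nodes t σ k.succ := monotone_nodes ht hσ k.castSucc_le_succ
    rw [intervalIntegral.integral_of_le hle, intervalIntegral.integral_of_le hle,
      integral_Ioc_eq_integral_Ioo, integral_Ioc_eq_integral_Ioo]
    refine setIntegral_congr_fun measurableSet_Ioo fun s hs => ?_
    simp only [bang_eq_of_mem_Ioo ht hσ k hs]
  · rw [uIcc_of_le ht]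
    exact uIcc_subset_Icc (nodes_mem_Icc ht hσ _) (nodes_mem_Icc ht hσ _)

/-- Rearranging the switching times increasingly does not change the switching control. -/
theorem exists_weyl_bang_eq {m : ℕ} {t : ℝ} (f : Fin m → ℝ) (hf : ∀ i, f i ∈ Icc 0 t) :
    ∃ σ ∈ weyl m t, bang σ = bang f :=
  ⟨f ∘ Tuple.sort f, ⟨Tuple.monotone_sort f, fun _ => hf _⟩, bang_comp_perm f _⟩

open Polynomial in
-- Each real root that is split off contributes one switch, and a polynomial without real roots has
-- constant sign by the intermediate value theorem. Surplus switches are placed at t, where they do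
-- not affect (0,t). The times come out unordered and are sorted afterwards.
theorem exists_switching_aux (m : ℕ) {t : ℝ} (ht : 0 ≤ t) (p : ℝ[X]) (hp : p ≠ 0)
    (hdeg : p.natDegree ≤ m) :
    ∃ f : Fin m → ℝ, (∀ i, f i ∈ Icc 0 t) ∧ ∃ ε : ℝ, (ε = 1 ∨ ε = -1) ∧
      ∀ s ∈ Ioo 0 t, 0 ≤ ε * p.eval s * bang f s := by
  induction m generalizing p with
  | zero =>
    have := eq_C_of_natDegree_le_zero hdeg
    refine ⟨fun _ => t, fun _ => ⟨ht, le_rfl⟩, ?_⟩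
    rcases le_total 0 (p.coeff 0) with h | h
    · exact ⟨1, Or.inl rfl, fun s _ => by rw [this]; simpa [bang] using h⟩
    · exact ⟨-1, Or.inr rfl, fun s _ => by rw [this]; simpa [bang] using h⟩
  | succ m ih =>
    by_cases hr : ∃ r, p.IsRoot r
    · obtain ⟨r, hr⟩ := hr
      obtain ⟨q, rfl⟩ := dvd_iff_isRoot.2 hr
      have hq : q ≠ 0 := right_ne_zero_of_mul hp
      rw [natDegree_mul (X_sub_C_ne_zero r) hq, natDegree_X_sub_C] at hdeg
      obtain ⟨f, hf, ε, hε, h⟩ := ih q hq (by omega)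
      -- The root is clamped into [0,t], which leaves the comparison with s ∈ (0,t) unchanged. The
      -- sign ε flips because X - r is negative before r, where the new factor of `bang` is 1.
      refine ⟨Fin.cons (max 0 (min t r)) f, ?_, -ε, ?_, ?_⟩
      · intro i
        induction i using Fin.cases with
        | zero => simp [ht]
        | succ i => simpa using hf i
      · rcases hε with rfl | rfl <;> simp
      · intro s hs
        have h1 : bang (Fin.cons (max 0 (min t r)) f) s = (if s < r then 1 else -1) * bang f s := by
          unfold bang
          rw [Fin.prod_univ_succ]
          simp only [Fin.cons_zero, Fin.cons_succ]
          congr 2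
          simp [hs.1.not_gt, hs.2]
        have h2 := h s hs
        have h3 : 0 ≤ (r - s) * (if s < r then 1 else -1) := by
          split_ifs <;> linarith
        rw [h1, eval_mul, eval_sub, eval_X, eval_C]
        have := mul_nonneg h2 h3
        linarith
    · push Not at hr
      refine ⟨fun _ => t, fun _ => ⟨ht, le_rfl⟩, ?_⟩
      have hb : ∀ s ∈ Ioo 0 t, bang (fun _ : Fin (m + 1) => t) s = 1 := by
        intro s hs
        simp [bang, hs.2]
      have hivt : (∀ s, 0 ≤ p.eval s) ∨ ∀ s, p.eval s ≤ 0 := by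
        by_contra! hcon
        obtain ⟨⟨a, ha⟩, b, hb⟩ := hcon
        obtain ⟨c, hc⟩ := mem_range_of_exists_le_of_exists_ge p.continuous ⟨a, ha.le⟩ ⟨b, hb.le⟩
        exact hr c hc
      rcases hivt with h | h
      · exact ⟨1, Or.inl rfl, fun s hs => by rw [hb s hs]; simpa using h s⟩
      · exact ⟨-1, Or.inr rfl, fun s hs => by rw [hb s hs]; simpa using h s⟩

open Polynomial in
/-- A nonzero polynomial of degree at most `m` has the sign of a control with `m` switches. -/
theorem exists_switching {m : ℕ} {t : ℝ} (ht : 0 ≤ t) {p : ℝ[X]} (hp : p ≠ 0)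
    (hdeg : p.natDegree ≤ m) :
    ∃ σ ∈ weyl m t, ∃ ε : ℝ, (ε = 1 ∨ ε = -1) ∧
      ∀ s ∈ Ioo 0 t, 0 ≤ ε * p.eval s * bang σ s := by
  obtain ⟨f, hf, h⟩ := exists_switching_aux m ht p hp hdeg
  obtain ⟨σ, hσ, hσf⟩ := exists_weyl_bang_eq f hf
  exact ⟨σ, hσ, by rwa [hσf]⟩

open Polynomial in
/-- Any choice of switching times is realised by a polynomial. -/
theorem exists_polynomial_of_switching {m : ℕ} (σ : Fin m → ℝ) :
    ∃ p : ℝ[X], p ≠ 0 ∧ p.natDegree ≤ m ∧ ∀ s, 0 ≤ p.eval s * bang σ s := by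
  refine ⟨∏ i, (C (σ i) - X), ?_, ?_, fun s => ?_⟩
  · refine Finset.prod_ne_zero_iff.2 fun i _ => ?_
    rw [← neg_ne_zero, neg_sub]
    exact X_sub_C_ne_zero _
  · refine (natDegree_prod_le _ _).trans ?_
    refine (Finset.sum_le_card_nsmul _ _ 1 fun i _ => ?_).trans (by simp)
    refine (natDegree_sub_le _ _).trans ?_
    simp
  · rw [eval_prod, bang, ← Finset.prod_mul_distrib]
    refine Finset.prod_nonneg fun i _ => ?_
    simp only [eval_sub, eval_C, eval_X]
    split_ifs <;> linarith

end SwitchingControls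

end LTIReach
namespace LTIReach

/-! ### Linear functionals as polynomials, and uniqueness of the maximizer -/

section Functionals

open Polynomial Filter Topology

/-- The coordinates of ξ are the monomials of degree 0 to m up to factorials, so the values of f on
the basis vectors are the coefficients of a polynomial in t - s, up to these factorials. -/
theorem exists_polynomial_of_functional {m : ℕ} (t : ℝ) {f : (Fin (m + 1) → ℝ) →L[ℝ] ℝ}
    (hf : f ≠ 0) :
    ∃ p : ℝ[X], p ≠ 0 ∧ p.natDegree ≤ m ∧ ∀ s, f (xi m (t - s)) = p.eval s := by
  set q : ℝ[X] := ∑ k : Fin (m + 1),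
    C (f (Pi.single k 1) / ((m - (k : ℕ))! : ℝ)) * X ^ (m - (k : ℕ)) with hq
  have hqdeg : q.natDegree ≤ m := by
    refine natDegree_sum_le_of_forall_le _ _ fun k _ => ?_
    exact (natDegree_C_mul_X_pow_le _ _).trans (Nat.sub_le _ _)
  have hcoeff : ∀ k : Fin (m + 1),
      q.coeff (m - k) = f (Pi.single k 1) / ((m - (k : ℕ))! : ℝ) := by
    intro k
    rw [hq, finsetSum_coeff, Finset.sum_eq_single k]
    · simp
    · intro l _ hl
      rw [coeff_C_mul_X_pow, if_neg]
      intro h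
      apply hl
      ext
      have := k.isLt
      have := l.isLt
      omega
    · simp
  have hq0 : q ≠ 0 := by
    intro h0
    apply hf
    ext x
    rw [pi_eq_sum_univ' x]
    have : ∀ k, f (Pi.single k 1) = 0 := by
      intro k
      have h := hcoeff k
      rw [h0, coeff_zero, eq_comm, div_eq_zero_iff] at h
      exact h.resolve_right (by positivity)
    simp [this]
  refine ⟨q.comp (C t - X), ?_, ?_, fun s => ?_⟩
  · intro h
    apply hq0
    -- The substitution s ↦ t - s is an involution, so it cannot annihilate q.
    have h1 : (q.comp (C t - X)).comp (C t - X) = q := by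
      rw [comp_assoc]
      simp
    rw [← h1, h, zero_comp]
  · rw [natDegree_comp]
    refine (Nat.mul_le_mul hqdeg (?_ : _ ≤ 1)).trans (by simp)
    refine (natDegree_sub_le _ _).trans ?_
    simp
  · rw [eval_comp, hq, eval_finsetSum]
    conv_lhs => rw [pi_eq_sum_univ' (xi m (t - s)), map_sum]
    refine Finset.sum_congr rfl fun k _ => ?_
    simp [xi]
    ring

theorem exists_functional_of_polynomial {m : ℕ} (t : ℝ) {p : ℝ[X]} (hp : p ≠ 0)
    (hdeg : p.natDegree ≤ m) :
    ∃ f : (Fin (m + 1) → ℝ) →L[ℝ] ℝ, f ≠ 0 ∧ ∀ s, f (xi m (t - s)) = p.eval s := by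
  set q : ℝ[X] := p.comp (C t - X) with hq
  have hqdeg : q.natDegree < m + 1 := by
    rw [hq, natDegree_comp]
    refine Nat.lt_succ_of_le ((Nat.mul_le_mul hdeg (?_ : _ ≤ 1)).trans (by simp))
    refine (natDegree_sub_le _ _).trans ?_
    simp
  set f : (Fin (m + 1) → ℝ) →L[ℝ] ℝ := ∑ k : Fin (m + 1),
    (((m - (k : ℕ))! : ℝ) * q.coeff (m - k)) • ContinuousLinearMap.proj k with hf
  have hfp : ∀ s, f (xi m (t - s)) = p.eval s := by
    intro s
    have h1 : p.eval s = q.eval (t - s) := by simp [hq]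
    rw [h1, eval_eq_sum_range' hqdeg, ← Finset.sum_range_reflect, Finset.sum_range]
    simp only [hf, sum_apply, smul_apply,
      ContinuousLinearMap.proj_apply, xi, smul_eq_mul]
    refine Finset.sum_congr rfl fun k _ => ?_
    have : ((m - (k : ℕ))! : ℝ) ≠ 0 := by positivity
    simp only [Nat.add_sub_cancel]
    field_simp
  refine ⟨f, fun h0 => hp (Polynomial.funext fun s => ?_), hfp⟩
  rw [← hfp, h0]
  simp

/-- The set of all `∫₀ᵗ w g` with `w` measurable and `|w| ≤ 1`. -/
def zonoid {E : Type*} [NormedAddCommGroup E] [NormedSpace ℝ E] (t : ℝ) (g : ℝ → E) : Set E :=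
  {y | ∃ w : ℝ → ℝ, Measurable w ∧ (∀ s, |w s| ≤ 1) ∧ y = ∫ s in (0 : ℝ)..t, w s • g s}

section

variable {E : Type*} [NormedAddCommGroup E] [NormedSpace ℝ E] {t : ℝ} {g : ℝ → E}

theorem zero_mem_zonoid : (0 : E) ∈ zonoid t g :=
  ⟨0, measurable_const, by simp, by simp⟩

theorem convex_zonoid (hg : IntervalIntegrable g volume 0 t) : Convex ℝ (zonoid t g) := by
  rintro _ ⟨w, hw, hwb, rfl⟩ _ ⟨v, hv, hvb, rfl⟩ a b ha hb hab
  refine ⟨fun s => a * w s + b * v s, (hw.const_mul a).add (hv.const_mul b), fun s => ?_, ?_⟩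
  · rw [abs_le]
    have h1 := abs_le.1 (hwb s)
    have h2 := abs_le.1 (hvb s)
    constructor <;> nlinarith
  · rw [← intervalIntegral.integral_smul, ← intervalIntegral.integral_smul,
      ← intervalIntegral.integral_add]
    · simp only [smul_smul, add_smul]
    · exact (intervalIntegrable_smul_of_abs_le hw hwb hg).smul a
    · exact (intervalIntegrable_smul_of_abs_le hv hvb hg).smul b

end

section

variable {m : ℕ} {t : ℝ} {μ : ℝ → ℝ}

theorem continuous_smul_xi (hμ : Continuous μ) : Continuous fun s => μ s • xi m (t - s) :=
  hμ.smul ((continuous_xi m).comp (continuous_const.sub continuous_id))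

theorem functional_integral (hμ : Continuous μ) (f : (Fin (m + 1) → ℝ) →L[ℝ] ℝ) {p : ℝ[X]}
    (hp : ∀ s, f (xi m (t - s)) = p.eval s) {w : ℝ → ℝ} (hw : Measurable w)
    (hwb : ∀ s, |w s| ≤ 1) :
    f (∫ s in (0 : ℝ)..t, w s • (μ s • xi m (t - s))) =
      ∫ s in (0 : ℝ)..t, w s • (μ s * p.eval s) := by
  rw [← ContinuousLinearMap.intervalIntegral_comp_comm f (intervalIntegrable_smul_of_abs_le hw hwb
    ((continuous_smul_xi hμ).intervalIntegrable _ _))]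
  simp only [map_smul, hp, smul_eq_mul]

/-- A switching control with the sign of `p` maximizes the functional given by `p`. -/
theorem functional_integral_le (ht : 0 ≤ t) (hμ : Continuous μ) (hμ0 : ∀ s, 0 ≤ μ s)
    (f : (Fin (m + 1) → ℝ) →L[ℝ] ℝ) {p : ℝ[X]} (hp : ∀ s, f (xi m (t - s)) = p.eval s)
    {σ : Fin m → ℝ} {ε : ℝ} (hε : |ε| = 1) (hσ : ∀ s ∈ Ioo 0 t, 0 ≤ ε * p.eval s * bang σ s)
    {y : Fin (m + 1) → ℝ} (hy : y ∈ zonoid t fun s => μ s • xi m (t - s)) :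
    f y ≤ f (ε • ∫ s in (0 : ℝ)..t, bang σ s • (μ s • xi m (t - s))) := by
  obtain ⟨w, hw, hwb, rfl⟩ := hy
  have hβ : ∀ s, |ε * bang σ s| ≤ 1 := fun s => by rw [abs_mul, hε, abs_bang, one_mul]
  have hβm := (measurable_bang σ).const_mul ε
  rw [← intervalIntegral.integral_smul]
  simp_rw [smul_smul ε]
  rw [functional_integral hμ f hp hw hwb, functional_integral hμ f hp hβm hβ]
  have hc : IntervalIntegrable (fun s => μ s * p.eval s) volume 0 t :=
    (hμ.mul p.continuous).intervalIntegrable _ _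
  refine intervalIntegral.integral_mono_on_of_le_Ioo ht (intervalIntegrable_smul_of_abs_le hw hwb hc)
    (intervalIntegrable_smul_of_abs_le hβm hβ hc) fun s hs => ?_
  have h1 : ε * bang σ s * p.eval s = |p.eval s| := by
    have : ε * bang σ s * p.eval s = ε * p.eval s * bang σ s := by ring
    rw [this, ← abs_of_nonneg (hσ s hs), abs_mul, abs_mul, hε, abs_bang, one_mul, mul_one]
  have h2 : w s * p.eval s ≤ |p.eval s| := by
    refine (le_abs_self _).trans ?_
    rw [abs_mul]
    exact mul_le_of_le_one_left (abs_nonneg _) (hwb s)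
  simp only [smul_eq_mul]
  have := mul_le_mul_of_nonneg_left (h2.trans h1.ge) (hμ0 s)
  linarith

/-- Quantitative uniqueness of the maximizer. Since β has the sign of p, |w - β| |p| = βp - wp
exactly. Weighting |w - β| by δ/(δ+|p|) and |p|/(δ+|p|) leaves a term that vanishes with δ off the
zeros of p, and a multiple of the loss βp - wp, whose integral against μ is the gap in the
functional. -/
theorem sub_switching_le {w β p δ : ℝ} (hδ : 0 < δ) (hw : |w| ≤ 1) (hβ : |β| = 1)
    (hp : 0 ≤ β * p) : |w - β| ≤ 2 * (δ / (δ + |p|)) + 1 / δ * (β * p - w * p) := by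
  have hp' : β * p = |p| := by rw [← abs_of_nonneg hp, abs_mul, hβ, one_mul]
  have hββ : β * β = 1 := by rw [← abs_mul_abs_self, hβ, one_mul]
  have h1 : |w - β| * |p| = β * p - w * p := by
    have hwβ : w * β ≤ 1 := by
      refine (le_abs_self _).trans ?_
      rw [abs_mul, hβ, mul_one]
      exact hw
    have h2 : |w - β| = 1 - w * β := by
      have : |w - β| = |(w - β) * β| := by rw [abs_mul, hβ, mul_one]
      rw [this, sub_mul, hββ, abs_sub_comm, abs_of_nonneg (by linarith)]
    rw [h2, ← hp']
    linear_combination (-w * p) * hββ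
  have h3 : |w - β| ≤ 2 := (abs_sub w β).trans (by linarith)
  have hpos : 0 < δ + |p| := by positivity
  have h4 : |w - β| = |w - β| * (δ / (δ + |p|)) + |w - β| * |p| / (δ + |p|) := by
    field_simp
  rw [h4, h1]
  have h5 : 0 ≤ β * p - w * p := by rw [← h1]; positivity
  refine add_le_add ?_ ?_
  · gcongr
  · rw [div_eq_mul_one_div, mul_comm]
    gcongr
    linarith [abs_nonneg p]

/-- Dominated convergence: the integrand tends to 0 away from the finitely many roots of p. -/
theorem tendsto_integral_div_add_abs (hμ : Continuous μ) {p : ℝ[X]} (hp : p ≠ 0) :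
    Tendsto (fun n : ℕ => ∫ s in (0 : ℝ)..t,
      (2 * ((1 / ((n : ℝ) + 1)) / (1 / ((n : ℝ) + 1) + |p.eval s|))) * μ s) atTop (𝓝 0) := by
  rw [show 𝓝 (0 : ℝ) = 𝓝 (∫ s in (0 : ℝ)..t, (0 : ℝ)) by simp]
  have hδ : ∀ n : ℕ, (0 : ℝ) < 1 / ((n : ℝ) + 1) := fun n => by positivity
  refine intervalIntegral.tendsto_integral_filter_of_dominated_convergence  (fun s => 2 * |μ s|)
    (Eventually.of_forall fun n => ?_) (Eventually.of_forall fun n => ?_) ?_ ?_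
  · refine Continuous.aestronglyMeasurable ?_
    refine (continuous_const.mul (continuous_const.div ?_ fun s => ?_)).mul hμ
    · exact continuous_const.add p.continuous.abs
    · have := hδ n
      positivity
  · refine Eventually.of_forall fun s _ => ?_
    have := hδ n
    generalize 1 / ((n : ℝ) + 1) = δ at this
    have h1 : 0 ≤ δ / (δ + |p.eval s|) := by positivity
    have h2 : δ / (δ + |p.eval s|) ≤ 1 :=
      div_le_one_of_le₀ (by linarith [abs_nonneg (p.eval s)]) (by positivity)
    rw [Real.norm_eq_abs, abs_mul, abs_mul, abs_two, abs_of_nonneg h1]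
    nlinarith [abs_nonneg (μ s)]
  · exact (continuous_const.mul hμ.abs).intervalIntegrable _ _
  · have hfin : (p.rootSet ℝ).Finite := p.rootSet_finite ℝ
    filter_upwards [(hfin.countable.ae_notMem volume)] with s hs _
    have hps : p.eval s ≠ 0 := by
      intro h
      exact hs (by rw [mem_rootSet]; exact ⟨hp, by simpa using h⟩)
    have h1 := tendsto_one_div_add_atTop_nhds_zero_nat (𝕜 := ℝ)
    have h2 := ((h1.div (h1.add_const |p.eval s|) (by simpa using hps)).const_mul 2).mul_const (μ s)
    simpa using h2

/-- A point of the closed zonoid on a supporting hyperplane is reached by a switching control. -/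
theorem eq_switching_of_isMax (ht : 0 ≤ t) (hμ : Continuous μ) (hμ0 : ∀ s, 0 ≤ μ s)
    {f : (Fin (m + 1) → ℝ) →L[ℝ] ℝ} (hf : f ≠ 0) {y : Fin (m + 1) → ℝ}
    (hy : y ∈ closure (zonoid t fun s => μ s • xi m (t - s)))
    (hmax : ∀ z ∈ zonoid t (fun s => μ s • xi m (t - s)), f z ≤ f y) :
    ∃ σ ∈ weyl m t, ∃ ε : ℝ, (ε = 1 ∨ ε = -1) ∧
      y = ε • ∫ s in (0 : ℝ)..t, bang σ s • (μ s • xi m (t - s)) := by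
  obtain ⟨p, hp0, hpdeg, hp⟩ := exists_polynomial_of_functional t hf
  obtain ⟨σ, hσ, ε, hε, hsign⟩ := exists_switching ht hp0 hpdeg
  refine ⟨σ, hσ, ε, hε, ?_⟩
  have hε1 : |ε| = 1 := by rcases hε with rfl | rfl <;> simp
  set g : ℝ → Fin (m + 1) → ℝ := fun s => μ s • xi m (t - s) with hg
  have hgc : Continuous g := continuous_smul_xi hμ
  have hgi : IntervalIntegrable g volume 0 t := hgc.intervalIntegrable _ _
  set β : ℝ → ℝ := fun s => ε * bang σ s with hβ
  have hβ1 : ∀ s, |β s| = 1 := fun s => by rw [hβ, abs_mul, hε1, abs_bang, one_mul]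
  have hβm : Measurable β := (measurable_bang σ).const_mul ε
  have hβi := intervalIntegrable_smul_of_abs_le hβm (fun s => (hβ1 s).le) hgi
  set z : Fin (m + 1) → ℝ := ∫ s in (0 : ℝ)..t, β s • g s with hz
  have hzε : ε • ∫ s in (0 : ℝ)..t, bang σ s • g s = z := by
    rw [hz, ← intervalIntegral.integral_smul]
    simp only [hβ, smul_smul ε]
  rw [hzε]
  have hzZ : z ∈ zonoid t g := ⟨β, hβm, fun s => (hβ1 s).le, rfl⟩
  obtain ⟨K, hK⟩ := (isCompact_Icc (a := (0 : ℝ)) (b := t)).exists_bound_of_continuousOn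
    (f := fun s => xi m (t - s))
    ((continuous_xi m).comp (continuous_const.sub continuous_id)).continuousOn
  have hK0 : 0 ≤ K := (norm_nonneg _).trans (hK 0 ⟨le_rfl, ht⟩)
  have hpc : IntervalIntegrable (fun s => μ s * p.eval s) volume 0 t :=
    (hμ.mul p.continuous).intervalIntegrable _ _
  -- A point of the closure need not come from any control w, so the estimate is stated as a closed
  -- condition on points, proved on the zonoid and extended to its closure.
  have key : ∀ δ > 0, closure (zonoid t g) ⊆ {x | ‖x - z‖ ≤
      K * ((∫ s in (0 : ℝ)..t, (2 * (δ / (δ + |p.eval s|))) * μ s) + 1 / δ * (f z - f x))} := by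
    intro δ hδ
    refine closure_minimal ?_ (isClosed_le (by fun_prop) (by fun_prop))
    rintro _ ⟨w, hw, hwb, rfl⟩
    have hwi := intervalIntegrable_smul_of_abs_le hw hwb hgi
    have hwp := intervalIntegrable_smul_of_abs_le hw hwb hpc
    have hβp := intervalIntegrable_smul_of_abs_le hβm (fun s => (hβ1 s).le) hpc
    have hJ : IntervalIntegrable (fun s => (2 * (δ / (δ + |p.eval s|))) * μ s) volume 0 t := by
      refine Continuous.intervalIntegrable ?_ _ _
      refine (continuous_const.mul (continuous_const.div ?_ fun s => ?_)).mul hμ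
      · exact continuous_const.add p.continuous.abs
      · positivity
    rw [mem_ofPred_eq, hz, functional_integral hμ f hp hw hwb,
      functional_integral hμ f hp hβm (fun s => (hβ1 s).le), ← intervalIntegral.integral_sub hβp hwp,
      ← intervalIntegral.integral_sub hwi hβi, ← intervalIntegral.integral_const_mul,
      ← intervalIntegral.integral_add hJ ((hβp.sub hwp).const_mul _),
      ← intervalIntegral.integral_const_mul]
    refine (intervalIntegral.norm_integral_le_integral_norm ht).trans ?_
    refine intervalIntegral.integral_mono_on_of_le_Ioo ht (hwi.sub hβi).norm
      ((hJ.add ((hβp.sub hwp).const_mul _)).const_mul _) fun s hs => ?_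
    rw [← sub_smul, hg, norm_smul, norm_smul, Real.norm_eq_abs, Real.norm_eq_abs,
      abs_of_nonneg (hμ0 s)]
    have h1 := sub_switching_le (p := p.eval s) hδ (hwb s) (hβ1 s) (by
      have := hsign s hs
      simp only [hβ]
      linarith)
    have h2 := hK s (Ioo_subset_Icc_self hs)
    calc |w s - β s| * (μ s * ‖xi m (t - s)‖)
        ≤ (2 * (δ / (δ + |p.eval s|)) + 1 / δ * (β s * p.eval s - w s * p.eval s)) * (μ s * K) := by
          refine mul_le_mul h1 ?_ (by have := hμ0 s; positivity) ((abs_nonneg _).trans h1)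
          exact mul_le_mul_of_nonneg_left h2 (hμ0 s)
      _ = _ := by simp only [smul_eq_mul]; ring
  have hfz : f z - f y ≤ 0 := by linarith [hmax z hzZ]
  have hlim := (tendsto_integral_div_add_abs (t := t) hμ hp0).const_mul K
  rw [mul_zero] at hlim
  -- Maximality of y makes the term with factor 1/δ nonpositive, however large 1/δ is; only the
  -- vanishing term remains.
  have hle : ‖y - z‖ ≤ 0 := by
    refine ge_of_tendsto' hlim fun n => ?_
    have hδ : (0 : ℝ) < 1 / ((n : ℝ) + 1) := by positivity
    refine (key _ hδ hy).trans (mul_le_mul_of_nonneg_left ?_ hK0)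
    have : 1 / (1 / ((n : ℝ) + 1)) * (f z - f y) ≤ 0 :=
      mul_nonpos_of_nonneg_of_nonpos (by positivity) hfz
    linarith
  exact sub_eq_zero.1 (norm_le_zero_iff.1 hle)

end

end Functionals

end LTIReach
namespace LTIReach

/-! ### Reachable sets: surjectivity of π, closure and boundary -/

section ReachableSets

open Filter Topology

/-- Supporting hyperplanes of convex sets with possibly empty interior. -/
theorem exists_supporting_functional {E : Type*} [NormedAddCommGroup E] [NormedSpace ℝ E]
    [FiniteDimensional ℝ E] {A : Set E} (hA : Convex ℝ A) (h0 : (0 : E) ∈ A) {y : E} (hyA : y ∈ A)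
    (hy : y ∉ interior A) : ∃ f : E →L[ℝ] ℝ, f ≠ 0 ∧ ∀ a ∈ A, f a ≤ f y := by
  by_cases hint : (interior A).Nonempty
  · exact geometric_hahn_banach_of_nonempty_interior_point hA hy hint
  -- With 0 ∈ A the affine span of A is its linear span, which is proper when the interior is empty;
  -- a nonzero functional vanishing on A then supports it everywhere.
  · have hspan : Submodule.span ℝ A ≠ ⊤ := by
      intro h
      apply hint
      rw [hA.interior_nonempty_iff_affineSpan_eq_top]
      have h1 := affineSpan_insert_zero (k := ℝ) A
      rw [insert_eq_of_mem h0, h] at h1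
      exact SetLike.coe_injective (by simpa using h1)
    obtain ⟨f, hf, hker⟩ := Submodule.exists_le_ker_of_lt_top _ (lt_top_iff_ne_top.2 hspan)
    have hz : ∀ a ∈ A, f a = 0 := fun a ha => LinearMap.mem_ker.1 (hker (Submodule.subset_span ha))
    refine ⟨LinearMap.toContinuousLinearMap f, ?_, fun a ha => ?_⟩
    · simpa using hf
    · simp [hz a ha, hz y hyA]

/-- A nonzero functional is an open map, so on the interior of A it stays strictly below its
maximum. -/
theorem notMem_interior_of_isMax {E : Type*} [NormedAddCommGroup E] [NormedSpace ℝ E]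
    {A : Set E} {f : E →L[ℝ] ℝ} (hf : f ≠ 0) {y : E} (hmax : ∀ a ∈ A, f a ≤ f y) :
    y ∉ interior A := by
  intro hy
  have h1 : interior A ⊆ f ⁻¹' (Iic (f y)) := fun a ha => hmax a (interior_subset ha)
  have h2 : f '' interior A ⊆ interior (Iic (f y)) :=
    interior_maximal (image_subset_iff.2 h1) (f.isOpenMap_of_ne_zero hf _ isOpen_interior)
  rw [interior_Iic] at h2
  exact lt_irrefl (f y) (h2 (mem_image_of_mem f hy))

variable {m : ℕ} {t : ℝ}

/-- Every point of the zonoid is a multiple, of modulus at most one, of a switching point. -/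
theorem exists_switching_of_mem_zonoid (ht : 0 ≤ t) {μ : ℝ → ℝ} (hμ : Continuous μ)
    (hμ0 : ∀ s, 0 ≤ μ s) {x : Fin (m + 1) → ℝ} (hx : x ∈ zonoid t fun s => μ s • xi m (t - s)) :
    ∃ σ ∈ weyl m t, ∃ r : ℝ, |r| ≤ 1 ∧
      x = r • ∫ s in (0 : ℝ)..t, bang σ s • (μ s • xi m (t - s)) := by
  by_cases hx0 : x = 0
  · exact ⟨fun _ => t, ⟨monotone_const, fun _ => ⟨ht, le_rfl⟩⟩, 0, by simp, by simp [hx0]⟩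
  set g : ℝ → Fin (m + 1) → ℝ := fun s => μ s • xi m (t - s) with hg
  have hgc : Continuous g := continuous_smul_xi hμ
  have hgi : IntervalIntegrable g volume 0 t := hgc.intervalIntegrable _ _
  set A := closure (zonoid t g) with hA
  have hbdd : A ⊆ Metric.closedBall 0 (∫ s in (0 : ℝ)..t, ‖g s‖) := by
    refine closure_minimal ?_ Metric.isClosed_closedBall
    rintro _ ⟨w, hw, hwb, rfl⟩
    rw [mem_closedBall_zero_iff]
    refine (intervalIntegral.norm_integral_le_integral_norm ht).trans ?_
    refine intervalIntegral.integral_mono_on ht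
      (intervalIntegrable_smul_of_abs_le hw hwb hgi).norm hgi.norm fun s _ => ?_
    rw [norm_smul]
    exact mul_le_of_le_one_left (norm_nonneg _) (hwb s)
  -- The multiples of x that stay in the closure; closedness and boundedness let the supremum R be
  -- attained, and Rx is not interior since a larger multiple would remain inside.
  set S : Set ℝ := (fun R : ℝ => R • x) ⁻¹' A with hS
  have hSc : IsClosed S := isClosed_closure.preimage (by fun_prop)
  have h1S : (1 : ℝ) ∈ S := by simpa [hS] using subset_closure hx
  have hSb : BddAbove S := by
    refine ⟨(∫ s in (0 : ℝ)..t, ‖g s‖) / ‖x‖, fun R hR => ?_⟩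
    have h := hbdd hR
    rw [mem_closedBall_zero_iff, norm_smul] at h
    rw [le_div_iff₀ (norm_pos_iff.2 hx0)]
    exact (mul_le_mul_of_nonneg_right (le_abs_self R) (norm_nonneg x)).trans h
  have hRS : sSup S ∈ S := hSc.csSup_mem ⟨1, h1S⟩ hSb
  have hR1 : 1 ≤ sSup S := le_csSup hSb h1S
  set R := sSup S with hR
  have hyint : R • x ∉ interior A := by
    intro hy
    have hopen : IsOpen ((fun R : ℝ => R • x) ⁻¹' interior A) :=
      isOpen_interior.preimage (by fun_prop)
    obtain ⟨δ, hδ, hball⟩ := Metric.isOpen_iff.1 hopen R hy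
    have hmem : R + δ / 2 ∈ (fun R : ℝ => R • x) ⁻¹' interior A := hball (by
      rw [Metric.mem_ball, Real.dist_eq, add_sub_cancel_left, abs_of_pos (by positivity)]
      linarith)
    have : R + δ / 2 ∈ S := (interior_subset hmem : (R + δ / 2) • x ∈ A)
    have := le_csSup hSb this
    linarith
  obtain ⟨f, hf, hmax⟩ := exists_supporting_functional (convex_zonoid hgi).closure
    (subset_closure zero_mem_zonoid) hRS hyint
  obtain ⟨σ, hσ, ε, hε, hy⟩ := eq_switching_of_isMax ht hμ hμ0 hf hRS
    fun z hz => hmax z (subset_closure hz)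
  refine ⟨σ, hσ, R⁻¹ * ε, ?_, ?_⟩
  · have hε1 : |ε| = 1 := by rcases hε with rfl | rfl <;> simp
    rw [abs_mul, hε1, mul_one, abs_of_nonneg (by positivity)]
    exact inv_le_one_of_one_le₀ hR1
  · rw [mul_smul, ← hy, smul_smul, inv_mul_cancel₀ (by positivity), one_smul]

variable {x₀ : Fin (m + 1) → ℝ} {umin umax : ℝ → ℝ}

theorem continuous_mu (hmin : Continuous umin) (hmax : Continuous umax) :
    Continuous (mu umin umax) := (hmax.sub hmin).div_const 2

theorem continuous_nu (hmin : Continuous umin) (hmax : Continuous umax) :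
    Continuous (nu umin umax) := (hmax.add hmin).div_const 2

theorem alternating_eq (ht : 0 ≤ t) (hmin : Continuous umin) (hmax : Continuous umax)
    {σ : Fin m → ℝ} (hσ : σ ∈ weyl m t) :
    alternating t umin umax σ =
      ∫ s in (0 : ℝ)..t, bang σ s • (mu umin umax s • xi m (t - s)) :=
  sum_integral_nodes ht hσ ((continuous_smul_xi (continuous_mu hmin hmax)).intervalIntegrable _ _)

theorem piMap_eq (σ : Fin m → ℝ) (r : ℝ) :
    piMap t x₀ umin umax (σ, r) =
      eta t x₀ umin umax + (2 * r - 1) • alternating t umin umax σ := by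
  simp only [piMap, xUpper, xLower]
  module

theorem eta_add_integral (hmin : Continuous umin) (hmax : Continuous umax) {w : ℝ → ℝ}
    (hw : Measurable w) (hwb : ∀ s, |w s| ≤ 1) :
    eta t x₀ umin umax + ∫ s in (0 : ℝ)..t, w s • (mu umin umax s • xi m (t - s)) =
      chi t x₀ + ∫ s in (0 : ℝ)..t, (nu umin umax s + w s * mu umin umax s) • xi m (t - s) := by
  rw [eta, add_assoc, ← intervalIntegral.integral_add
    ((continuous_smul_xi (continuous_nu hmin hmax)).intervalIntegrable _ _)
    (intervalIntegrable_smul_of_abs_le hw hwb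
      ((continuous_smul_xi (continuous_mu hmin hmax)).intervalIntegrable _ _))]
  simp only [add_smul, mul_smul]

theorem nu_add_mem_Icc {w s : ℝ} (hle : umin s ≤ umax s) (hw : |w| ≤ 1) :
    nu umin umax s + w * mu umin umax s ∈ Icc (umin s) (umax s) := by
  rw [abs_le] at hw
  unfold nu mu
  constructor <;> nlinarith

/-- The substitution u = ν + wμ normalizes the constraint to |w| ≤ 1. -/
theorem reachSet_eq (ht : 0 ≤ t) (hmin : Continuous umin) (hmax : Continuous umax)
    (hle : ∀ s, umin s ≤ umax s) :
    reachSet t x₀ umin umax = (fun z => eta t x₀ umin umax + z) ''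
      zonoid t fun s => mu umin umax s • xi m (t - s) := by
  have hμc := continuous_mu hmin hmax
  have hνc := continuous_nu hmin hmax
  apply Subset.antisymm
  · rintro _ ⟨u, x, hu, hub, hx, rfl⟩
    -- Where μ = 0 the constraint forces u = ν, and the default value 0 of the quotient is the right
    -- choice. The indicator makes |w| ≤ 1 hold globally, since u is unconstrained off [0,t].
    set w : ℝ → ℝ := (Icc 0 t).indicator
      (fun s => (u s - nu umin umax s) / mu umin umax s) with hw
    have hwm : Measurable w :=
      ((hu.sub hνc.measurable).div hμc.measurable).indicator measurableSet_Icc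
    have hwb : ∀ s, |w s| ≤ 1 := by
      intro s
      rw [hw, indicator]
      split_ifs with hs
      · rw [abs_div]
        refine div_le_one_of_le₀ ?_ (abs_nonneg _)
        have h1 := hub s hs
        refine le_trans ?_ (le_abs_self _)
        simp only [nu, mu]
        rw [abs_le]
        constructor <;> linarith [h1.1, h1.2]
      · simp
    have hwu : ∀ s ∈ Icc 0 t, nu umin umax s + w s * mu umin umax s = u s := by
      intro s hs
      rw [hw, indicator_of_mem hs]
      by_cases h0 : mu umin umax s = 0
      · have h1 := hub s hs
        simp only [mu] at h0
        simp only [mu, h0, nu, mul_zero, add_zero]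
        linarith [h1.1, h1.2]
      · field_simp
        ring
    have hui : IntervalIntegrable u volume 0 t := by
      have h1 : IntervalIntegrable (fun s => nu umin umax s + w s * mu umin umax s) volume 0 t :=
        (hνc.intervalIntegrable _ _).add
          (intervalIntegrable_smul_of_abs_le hwm hwb (hμc.intervalIntegrable _ _))
      refine h1.congr fun s hs => hwu s ?_
      rw [uIoc_of_le ht] at hs
      exact Ioc_subset_Icc_self hs
    refine ⟨_, ⟨w, hwm, hwb, rfl⟩, ?_⟩
    beta_reduce
    rw [eta_add_integral hmin hmax hwm hwb, hx.apply_eq ht hui]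
    congr 1
    refine intervalIntegral.integral_congr fun s hs => ?_
    rw [uIcc_of_le ht] at hs
    simp only [hwu s hs]
  · rintro _ ⟨_, ⟨w, hw, hwb, rfl⟩, rfl⟩
    have hui : ∀ a b, IntervalIntegrable (fun s => nu umin umax s + w s * mu umin umax s)
        volume a b := fun a b => (hνc.intervalIntegrable _ _).add
          (intervalIntegrable_smul_of_abs_le hw hwb (hμc.intervalIntegrable _ _))
    have htr := isTrajectory_integratorState t x₀ hui
    refine ⟨_, _, hνc.measurable.add (hw.mul hμc.measurable),
      fun s _ => nu_add_mem_Icc (hle s) (hwb s), htr, ?_⟩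
    rw [htr.apply_eq ht (hui _ _)]
    exact (eta_add_integral hmin hmax hw hwb).symm

theorem IsTrajectory.congr_input {u v : ℝ → ℝ} {x : ℝ → Fin (m + 1) → ℝ}
    (h : IsTrajectory t x₀ u x) (huv : EqOn u v (Icc 0 t)) : IsTrajectory t x₀ v x := by
  refine ⟨h.1, fun s hs => ?_⟩
  rw [h.2 s hs]
  congr 1
  refine intervalIntegral.integral_congr fun τ hτ => ?_
  rw [uIcc_of_le hs.1] at hτ
  simp only [huv ⟨hτ.1, hτ.2.trans hs.2⟩]

theorem contReachSet_subset_reachSet (ht : 0 ≤ t) :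
    contReachSet t x₀ umin umax ⊆ reachSet t x₀ umin umax := by
  rintro _ ⟨u, x, hu, hub, hx, rfl⟩
  -- The input is continuous only on [0,t]; its constant extension is continuous everywhere, hence
  -- measurable.
  have heq : EqOn u (IccExtend ht ((Icc 0 t).domRestrict u)) (Icc 0 t) := fun s hs => by
    rw [IccExtend_of_mem _ _ hs]; rfl
  refine ⟨_, x, (continuous_IccExtend_iff.2 (continuousOn_iff_continuous_domRestrict.1 hu)).measurable,
    fun s hs => ?_, (hx.isTrajectory hu).congr_input heq, rfl⟩
  rw [← heq hs]
  exact hub s hs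

/-- Continuous functions of compact support are dense in L¹; clamping to [-1,1] is 1-Lipschitz and
fixes w, so it does not increase the distance. -/
theorem exists_continuous_control_near (ht : 0 ≤ t) {w : ℝ → ℝ} (hw : Measurable w)
    (hwb : ∀ s, |w s| ≤ 1) {ε : ℝ} (hε : 0 < ε) :
    ∃ v : ℝ → ℝ, Continuous v ∧ (∀ s, |v s| ≤ 1) ∧ ∫ s in (0 : ℝ)..t, |w s - v s| ≤ ε := by
  have hint : Integrable ((Ioc 0 t).indicator w) := by
    rw [integrable_indicator_iff measurableSet_Ioc]
    refine Measure.integrableOn_of_bounded (M := 1) (by simp) hw.aestronglyMeasurable ?_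
    exact Eventually.of_forall hwb
  obtain ⟨h, -, hle, hc, hi⟩ := hint.exists_hasCompactSupport_integral_sub_le hε
  refine ⟨fun s => max (-1) (min 1 (h s)), by fun_prop, fun s => ?_, ?_⟩
  · rw [abs_le]
    exact ⟨le_max_left _ _, max_le (by norm_num) (min_le_left _ _)⟩
  · refine le_trans ?_ hle
    rw [intervalIntegral.integral_of_le ht, ← integral_indicator measurableSet_Ioc]
    refine integral_mono_of_nonneg (Eventually.of_forall fun s => ?_) (hint.sub hi).norm
      (Eventually.of_forall fun s => ?_)
    · exact indicator_nonneg (fun s _ => abs_nonneg _) s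
    · simp only [indicator]
      split_ifs with hs
      · have h1 := abs_le.1 (hwb s)
        rw [Real.norm_eq_abs]
        have h2 : w s = max (-1) (min 1 (w s)) := by
          rw [min_eq_right h1.2, max_eq_right h1.1]
        conv_lhs => rw [h2]
        have h3 := abs_max_sub_max_le_max (-1) (min 1 (w s)) (-1) (min 1 (h s))
        have h4 := abs_min_sub_min_le_max 1 (w s) 1 (h s)
        simp only [sub_self, abs_zero, abs_nonneg, sup_of_le_right] at h3 h4
        exact h3.trans h4
      · positivity

theorem reachSet_subset_closure_contReachSet (ht : 0 ≤ t) (hmin : Continuous umin)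
    (hmax : Continuous umax) (hle : ∀ s, umin s ≤ umax s) :
    reachSet t x₀ umin umax ⊆ closure (contReachSet t x₀ umin umax) := by
  rw [reachSet_eq ht hmin hmax hle]
  rintro _ ⟨_, ⟨w, hw, hwb, rfl⟩, rfl⟩
  have hμc := continuous_mu hmin hmax
  have hνc := continuous_nu hmin hmax
  have hgc := continuous_smul_xi (m := m) (t := t) hμc
  have hgi := hgc.intervalIntegrable (μ := volume) 0 t
  obtain ⟨K, hK⟩ := (isCompact_Icc (a := (0 : ℝ)) (b := t)).exists_bound_of_continuousOn
    hgc.continuousOn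
  have hK0 : 0 ≤ K := (norm_nonneg _).trans (hK 0 ⟨le_rfl, ht⟩)
  rw [Metric.mem_closure_iff]
  intro ε hε
  obtain ⟨v, hv, hvb, hwv⟩ := exists_continuous_control_near ht hw hwb
    (show 0 < ε / (K + 1) by positivity)
  have hwi := intervalIntegrable_smul_of_abs_le hw hwb hgi
  have hvi := intervalIntegrable_smul_of_abs_le hv.measurable hvb hgi
  refine ⟨eta t x₀ umin umax + ∫ s in (0 : ℝ)..t, v s • (mu umin umax s • xi m (t - s)), ?_, ?_⟩
  · have huc : Continuous fun s => nu umin umax s + v s * mu umin umax s := hνc.add (hv.mul hμc)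
    have htr := isClassicalTrajectory_integratorState t x₀ huc
    refine ⟨_, _, huc.continuousOn, fun s _ => nu_add_mem_Icc (hle s) (hvb s), htr, ?_⟩
    rw [(htr.isTrajectory huc.continuousOn).apply_eq ht (huc.intervalIntegrable _ _)]
    exact (eta_add_integral hmin hmax hv.measurable hvb).symm
  · rw [dist_add_left, dist_eq_norm, ← intervalIntegral.integral_sub hwi hvi]
    have hwvi : IntervalIntegrable (fun s => |w s - v s|) volume 0 t := by
      have h1 : IntervalIntegrable w volume 0 t := by
        simpa using intervalIntegrable_smul_of_abs_le hw hwb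
          (continuous_const (y := (1 : ℝ)).intervalIntegrable (μ := volume) 0 t)
      exact (h1.sub (hv.intervalIntegrable _ _)).abs
    calc ‖∫ s in (0 : ℝ)..t, (w s • (mu umin umax s • xi m (t - s)) -
          v s • (mu umin umax s • xi m (t - s)))‖
        ≤ ∫ s in (0 : ℝ)..t, |w s - v s| * K := by
          refine intervalIntegral.norm_integral_le_of_norm_le ht
            (Eventually.of_forall fun s hs => ?_) (hwvi.mul_const K)
          rw [← sub_smul, norm_smul]
          exact mul_le_mul_of_nonneg_left (hK s (Ioc_subset_Icc_self hs)) (norm_nonneg _)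
      _ ≤ ε / (K + 1) * K := by
          rw [intervalIntegral.integral_mul_const]
          exact mul_le_mul_of_nonneg_right hwv hK0
      _ < ε := by
          rw [div_mul_eq_mul_div, div_lt_iff₀ (by positivity)]
          nlinarith

theorem isCompact_weyl (m : ℕ) (t : ℝ) : IsCompact (weyl m t) := by
  have h : weyl m t = {σ | Monotone σ} ∩ Set.pi univ fun _ => Icc 0 t := by
    ext σ
    simp only [weyl, mem_ofPred_eq, mem_inter_iff, mem_univ_pi]
  rw [h]
  exact (isCompact_univ_pi fun _ => isCompact_Icc).inter_left isClosed_monotone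

theorem continuous_nodes (i : Fin (m + 2)) : Continuous fun σ : Fin m → ℝ => nodes t σ i := by
  induction i using Fin.cases with
  | zero => exact continuous_const
  | succ i =>
    simp only [nodes, Fin.cons_succ]
    induction i using Fin.lastCases with
    | last => simpa using continuous_const
    | cast i => simpa using continuous_apply i

theorem continuous_piMap (hmin : Continuous umin) (hmax : Continuous umax) :
    Continuous (piMap t x₀ umin umax) := by
  have hgc := continuous_smul_xi (m := m) (t := t) (continuous_mu hmin hmax)
  have halt : Continuous (alternating (m := m) t umin umax) := by
    unfold alternating
    refine continuous_finsetSum _ fun k _ => Continuous.fun_const_smul ?_ _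
    have hF := intervalIntegral.continuous_primitive (μ := volume)
      (fun a b => hgc.intervalIntegrable a b) 0
    have : ∀ a b, ∫ s in a..b, mu umin umax s • xi m (t - s) =
        (∫ s in (0 : ℝ)..b, mu umin umax s • xi m (t - s)) -
          ∫ s in (0 : ℝ)..a, mu umin umax s • xi m (t - s) := fun a b =>
      (intervalIntegral.integral_interval_sub_left (hgc.intervalIntegrable _ _)
        (hgc.intervalIntegrable _ _)).symm
    exact ((hF.comp (continuous_nodes _)).sub (hF.comp (continuous_nodes _))).congr
      fun σ => (this _ _).symm
  have : piMap t x₀ umin umax = fun p : (Fin m → ℝ) × ℝ =>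
      eta t x₀ umin umax + (2 * p.2 - 1) • alternating t umin umax p.1 :=
    funext fun p => piMap_eq p.1 p.2
  rw [this]
  fun_prop

theorem mapsTo_piMap (ht : 0 ≤ t) (hmin : Continuous umin) (hmax : Continuous umax)
    (hle : ∀ s, umin s ≤ umax s) :
    MapsTo (piMap t x₀ umin umax) (weyl m t ×ˢ Icc (0 : ℝ) 1) (reachSet t x₀ umin umax) := by
  rintro ⟨σ, r⟩ ⟨hσ, hr⟩
  rw [reachSet_eq ht hmin hmax hle, piMap_eq, alternating_eq ht hmin hmax hσ,
    ← intervalIntegral.integral_smul]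
  refine mem_image_of_mem _ ⟨fun s => (2 * r - 1) * bang σ s, (measurable_bang σ).const_mul _,
    fun s => ?_, ?_⟩
  · rw [abs_mul, abs_bang, mul_one, abs_le]
    constructor <;> linarith [hr.1, hr.2]
  · simp only [smul_smul (2 * r - 1)]

theorem surjOn_piMap (ht : 0 ≤ t) (hmin : Continuous umin) (hmax : Continuous umax)
    (hle : ∀ s, umin s ≤ umax s) :
    SurjOn (piMap t x₀ umin umax) (weyl m t ×ˢ Icc (0 : ℝ) 1) (reachSet t x₀ umin umax) := by
  rw [reachSet_eq ht hmin hmax hle]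
  rintro _ ⟨z, hz, rfl⟩
  obtain ⟨σ, hσ, r, hr, rfl⟩ := exists_switching_of_mem_zonoid ht (continuous_mu hmin hmax)
    (fun s => div_nonneg (sub_nonneg.2 (hle s)) two_pos.le) hz
  rw [abs_le] at hr
  -- The parameter λ solves 2λ - 1 = r.
  refine ⟨(σ, (r + 1) / 2), ⟨hσ, ?_⟩, ?_⟩
  · constructor <;> simp only <;> linarith
  · rw [piMap_eq, alternating_eq ht hmin hmax hσ]
    congr 2
    ring

/-- The image is the measurable reachable set, in which continuous inputs are dense; it is closed as
a continuous image of a compact set. -/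
theorem image_piMap_eq_closure (ht : 0 ≤ t) (hmin : Continuous umin) (hmax : Continuous umax)
    (hle : ∀ s, umin s ≤ umax s) :
    piMap t x₀ umin umax '' (weyl m t ×ˢ Icc (0 : ℝ) 1) =
      closure (contReachSet t x₀ umin umax) := by
  apply Subset.antisymm
  · exact (mapsTo_piMap ht hmin hmax hle).image_subset.trans
      (reachSet_subset_closure_contReachSet ht hmin hmax hle)
  · refine closure_minimal ?_ ?_
    · exact (contReachSet_subset_reachSet ht).trans (surjOn_piMap ht hmin hmax hle)
    · exact (((isCompact_weyl m t).prod isCompact_Icc).image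
        (continuous_piMap hmin hmax)).isClosed

/-- Switching points are exposed by a functional on the whole reachable set. -/
theorem exists_functional_isMax (ht : 0 ≤ t) (hmin : Continuous umin) (hmax : Continuous umax)
    (hle : ∀ s, umin s ≤ umax s) {σ : Fin m → ℝ} (hσ : σ ∈ weyl m t) {ε : ℝ}
    (hε : ε = 1 ∨ ε = -1) :
    ∃ f : (Fin (m + 1) → ℝ) →L[ℝ] ℝ, f ≠ 0 ∧ ∀ z ∈ reachSet t x₀ umin umax,
      f z ≤ f (eta t x₀ umin umax + ε • alternating t umin umax σ) := by
  obtain ⟨p, hp0, hpdeg, hp⟩ := exists_polynomial_of_switching σ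
  have hε1 : |ε| = 1 := by rcases hε with rfl | rfl <;> simp
  have hεε : ε * ε = 1 := by rcases hε with rfl | rfl <;> simp
  have hε0 : ε ≠ 0 := by rintro rfl; simp at hεε
  -- The functional belongs to εp, so that ε · (εp) · `bang σ` = p · `bang σ` ≥ 0.
  obtain ⟨f, hf0, hf⟩ := exists_functional_of_polynomial t
    (mul_ne_zero (Polynomial.C_ne_zero.2 hε0) hp0)
    ((Polynomial.natDegree_C_mul_le ε p).trans hpdeg)
  refine ⟨f, hf0, ?_⟩
  rw [reachSet_eq ht hmin hmax hle, alternating_eq ht hmin hmax hσ]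
  rintro _ ⟨z, hz, rfl⟩
  rw [map_add, map_add]
  gcongr
  refine functional_integral_le ht (continuous_mu hmin hmax)
    (fun s => div_nonneg (sub_nonneg.2 (hle s)) two_pos.le) f hf hε1 (fun s _ => ?_) hz
  rw [Polynomial.eval_mul, Polynomial.eval_C, ← mul_assoc, hεε, one_mul]
  exact hp s

theorem mem_frontier_of_switching (ht : 0 ≤ t) (hmin : Continuous umin) (hmax : Continuous umax)
    (hle : ∀ s, umin s ≤ umax s) {σ : Fin m → ℝ} (hσ : σ ∈ weyl m t) {ε : ℝ}
    (hε : ε = 1 ∨ ε = -1) :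
    eta t x₀ umin umax + ε • alternating t umin umax σ ∈ frontier (reachSet t x₀ umin umax) ∧
    eta t x₀ umin umax + ε • alternating t umin umax σ ∈
      frontier (contReachSet t x₀ umin umax) := by
  have hmem : eta t x₀ umin umax + ε • alternating t umin umax σ ∈ reachSet t x₀ umin umax := by
    have h : eta t x₀ umin umax + ε • alternating t umin umax σ =
        piMap t x₀ umin umax (σ, (ε + 1) / 2) := by
      rw [piMap_eq]
      congr 2
      ring
    rw [h]
    refine mapsTo_piMap ht hmin hmax hle ⟨hσ, ?_⟩
    rcases hε with rfl | rfl <;> norm_num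
  obtain ⟨f, hf0, hf⟩ := exists_functional_isMax (x₀ := x₀) ht hmin hmax hle hσ hε
  exact ⟨⟨subset_closure hmem, notMem_interior_of_isMax hf0 hf⟩,
    ⟨reachSet_subset_closure_contReachSet ht hmin hmax hle hmem,
      notMem_interior_of_isMax hf0 fun z hz => hf z (contReachSet_subset_reachSet ht hz)⟩⟩

end ReachableSets

end LTIReach
namespace LTIReach

/-! ### Continuity of the range induced by a controllable system -/

section InducedRange

open Filter Topology

/-- A continuous approximation of the control on `[0, s]` that takes the value `b` where `f > 0`
and `a` elsewhere, with the value `a` at `s`. -/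
noncomputable def smoothedSwitch (f : ℝ → ℝ) (a b s : ℝ) (n : ℕ) (τ : ℝ) : ℝ :=
  a + (b - a) * (min 1 (n * max (f τ) 0) * min 1 (n * max (s - τ) 0))

theorem continuous_smoothedSwitch {f : ℝ → ℝ} (hf : Continuous f) (a b s : ℝ) (n : ℕ) :
    Continuous (smoothedSwitch f a b s n) := by
  unfold smoothedSwitch
  fun_prop

theorem smoothedSwitch_self (f : ℝ → ℝ) (a b s : ℝ) (n : ℕ) : smoothedSwitch f a b s n s = a := by
  simp [smoothedSwitch]

theorem smoothedSwitch_mem_Icc (f : ℝ → ℝ) {a b : ℝ} (hab : a ≤ b) (s : ℝ) (n : ℕ) (τ : ℝ) :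
    smoothedSwitch f a b s n τ ∈ Icc a b := by
  unfold smoothedSwitch
  have h1 : 0 ≤ min 1 ((n : ℝ) * max (f τ) 0) := le_min zero_le_one (by positivity)
  have h2 : min 1 ((n : ℝ) * max (f τ) 0) ≤ 1 := min_le_left _ _
  have h3 : 0 ≤ min 1 ((n : ℝ) * max (s - τ) 0) := le_min zero_le_one (by positivity)
  have h4 : min 1 ((n : ℝ) * max (s - τ) 0) ≤ 1 := min_le_left _ _
  have h5 := mul_nonneg h1 h3
  have h6 := mul_le_one₀ h2 h3 h4
  constructor
  · nlinarith
  · nlinarith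

theorem tendsto_mul_smoothedSwitch (f : ℝ → ℝ) {a b : ℝ} (hab : a ≤ b) {s τ : ℝ} (hτ : τ < s) :
    Tendsto (fun n => f τ * smoothedSwitch f a b s n τ) atTop
      (𝓝 (max (f τ * a) (f τ * b))) := by
  rcases le_or_gt (f τ) 0 with h | h
  · have h1 : ∀ n, smoothedSwitch f a b s n τ = a := fun n => by simp [smoothedSwitch, h]
    rw [max_eq_left (mul_le_mul_of_nonpos_left hab h)]
    simp only [h1]
    exact tendsto_const_nhds
  · rw [max_eq_right (mul_le_mul_of_nonneg_left hab h.le)]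
    refine Tendsto.congr' ?_ tendsto_const_nhds
    have hlarge : ∀ c : ℝ, 0 < c → ∀ᶠ n : ℕ in atTop, 1 ≤ (n : ℝ) * c := fun c hc =>
      (tendsto_natCast_atTop_atTop.atTop_mul_const hc).eventually_ge_atTop 1
    filter_upwards [hlarge _ h, hlarge _ (sub_pos.2 hτ)] with n h1 h2
    rw [smoothedSwitch, max_eq_left h.le, max_eq_left (sub_pos.2 hτ).le, min_eq_left h1,
      min_eq_left h2]
    ring

/-- The value at the single point s does not affect the integral, so both terms are optimized
independently: v(s) = a, and the integrand takes its pointwise maximum. The smoothed switches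
approach this bound by dominated convergence. -/
theorem isGLB_input_functional {f : ℝ → ℝ} (hf : Continuous f) {a b s : ℝ} (hab : a ≤ b)
    (hs : 0 ≤ s) :
    IsGLB ((fun v : ℝ → ℝ => v s - ∫ τ in (0 : ℝ)..s, f τ * v τ) '' contInputs s a b)
      (a - ∫ τ in (0 : ℝ)..s, max (f τ * a) (f τ * b)) := by
  have hmax : Continuous fun τ => max (f τ * a) (f τ * b) := by fun_prop
  constructor
  · rintro _ ⟨v, ⟨hvc, hvb⟩, rfl⟩
    refine sub_le_sub (hvb s ⟨hs, le_rfl⟩).1 ?_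
    refine intervalIntegral.integral_mono_on hs
      ((hf.continuousOn.mul hvc).intervalIntegrable_of_Icc hs)
      (hmax.intervalIntegrable _ _) fun τ hτ => ?_
    rcases le_total (f τ) 0 with h | h
    · exact le_max_of_le_left (mul_le_mul_of_nonpos_left (hvb τ hτ).1 h)
    · exact le_max_of_le_right (mul_le_mul_of_nonneg_left (hvb τ hτ).2 h)
  · intro c hc
    have hn : ∀ n, c ≤ a - ∫ τ in (0 : ℝ)..s, f τ * smoothedSwitch f a b s n τ := by
      intro n
      have hmem : smoothedSwitch f a b s n ∈ contInputs s a b :=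
        ⟨(continuous_smoothedSwitch hf a b s n).continuousOn,
          fun τ _ => smoothedSwitch_mem_Icc f hab s n τ⟩
      have h := hc (mem_image_of_mem _ hmem)
      simpa only [smoothedSwitch_self] using h
    refine ge_of_tendsto' (x := atTop) (tendsto_const_nhds.sub ?_) hn
    refine intervalIntegral.tendsto_integral_filter_of_dominated_convergence
      (fun τ => |f τ| * max |a| |b|) (Eventually.of_forall fun n => ?_)
      (Eventually.of_forall fun n => Eventually.of_forall fun τ _ => ?_)
      ((hf.abs.mul continuous_const).intervalIntegrable _ _) ?_
    · exact (hf.mul (continuous_smoothedSwitch hf a b s n)).aestronglyMeasurable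
    · rw [Real.norm_eq_abs, abs_mul]
      have h := smoothedSwitch_mem_Icc f hab s n τ
      exact mul_le_mul_of_nonneg_left (abs_le_max_abs_abs h.1 h.2) (abs_nonneg _)
    · filter_upwards [(countable_singleton s).ae_notMem volume] with τ hτ hτs
      rw [uIoc_of_le hs] at hτs
      exact tendsto_mul_smoothedSwitch f hab (lt_of_le_of_ne hτs.2 hτ)

/-- The map v ↦ -v exchanges infimum and supremum and turns [a,b] into [-b,-a]. -/
theorem isLUB_input_functional {f : ℝ → ℝ} (hf : Continuous f) {a b s : ℝ} (hab : a ≤ b)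
    (hs : 0 ≤ s) :
    IsLUB ((fun v : ℝ → ℝ => v s - ∫ τ in (0 : ℝ)..s, f τ * v τ) '' contInputs s a b)
      (b + ∫ τ in (0 : ℝ)..s, max (f τ * -b) (f τ * -a)) := by
  have h := (isGLB_input_functional hf (neg_le_neg hab) hs).neg
  have hset : -((fun v : ℝ → ℝ => v s - ∫ τ in (0 : ℝ)..s, f τ * v τ) '' contInputs s (-b) (-a)) =
      (fun v : ℝ → ℝ => v s - ∫ τ in (0 : ℝ)..s, f τ * v τ) '' contInputs s a b := by
    have hI : ∀ v : ℝ → ℝ, (-v) s - ∫ τ in (0 : ℝ)..s, f τ * (-v) τ =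
        -(v s - ∫ τ in (0 : ℝ)..s, f τ * v τ) := by
      intro v
      simp only [Pi.neg_apply, mul_neg, intervalIntegral.integral_neg]
      ring
    ext x
    constructor
    · rintro ⟨v, ⟨hvc, hvb⟩, hv⟩
      refine ⟨-v, ⟨hvc.neg, fun τ hτ => ?_⟩, ?_⟩
      · have := hvb τ hτ
        exact ⟨le_neg.1 this.2, neg_le.1 this.1⟩
      · beta_reduce at hv ⊢
        rw [hI, hv, neg_neg]
    · rintro ⟨v, ⟨hvc, hvb⟩, rfl⟩
      refine ⟨-v, ⟨hvc.neg, fun τ hτ => ?_⟩, hI v⟩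
      have := hvb τ hτ
      exact ⟨neg_le_neg this.2, neg_le_neg this.1⟩
  rw [hset] at h
  rwa [neg_sub, sub_neg_eq_add, add_comm] at h

variable {m : ℕ}

theorem continuous_matrix_exp_smul (M : Matrix (Fin (m + 1)) (Fin (m + 1)) ℝ) :
    Continuous fun r : ℝ => NormedSpace.exp (r • M) := by
  let : NormedRing (Matrix (Fin (m + 1)) (Fin (m + 1)) ℝ) := Matrix.linftyOpNormedRing
  let : NormedAlgebra ℝ (Matrix (Fin (m + 1)) (Fin (m + 1)) ℝ) := Matrix.linftyOpNormedAlgebra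
  let : NormedAlgebra ℚ (Matrix (Fin (m + 1)) (Fin (m + 1)) ℝ) :=
    NormedAlgebra.restrictScalars ℚ ℝ _
  exact NormedSpace.exp_continuous.comp (continuous_id.smul continuous_const)

theorem continuous_dotProduct_exp (M : Matrix (Fin (m + 1)) (Fin (m + 1)) ℝ)
    (c y : Fin (m + 1) → ℝ) :
    Continuous fun r : ℝ => c ⬝ᵥ (NormedSpace.exp (r • M) *ᵥ y) :=
  continuous_const.dotProduct ((continuous_matrix_exp_smul M).matrix_mulVec continuous_const)

/-- The explicit extrema are constants plus or minus integrals of continuous functions of s - τ, and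
the free response is continuous in s. Any admissible input separates the infimum from the supremum.
-/
theorem IsInducedByLTI.isContinuousRange {x₀ : Fin (m + 1) → ℝ} {umin umax : ℝ → ℝ}
    (h : IsInducedByLTI x₀ umin umax) (t : ℝ) : IsContinuousRange t umin umax := by
  obtain ⟨A, b, z₀, vmin, vmax, -, hv, -, rfl, rfl⟩ := h
  set k : ℝ → ℝ := fun r => cvec A ⬝ᵥ (NormedSpace.exp (r • Acon A b) *ᵥ bcon m) with hk
  have hkc : Continuous k := continuous_dotProduct_exp _ _ _
  have hfc : ∀ s, Continuous fun τ => fker A b s τ := fun s =>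
    hkc.comp (continuous_const.sub continuous_id)
  have hglb := fun s (hs : s ∈ Icc 0 t) => isGLB_input_functional (hfc s) hv hs.1
  have hlub := fun s (hs : s ∈ Icc 0 t) => isLUB_input_functional (hfc s) hv hs.1
  have hne : ∀ s, (Ifun A b s '' contInputs s vmin vmax).Nonempty := fun s =>
    ⟨_, mem_image_of_mem _ ⟨continuousOn_const, fun _ _ => ⟨le_rfl, hv⟩⟩⟩
  -- Substituting s - τ removes s from the integrand and leaves a primitive of F.
  have hprim : ∀ F : ℝ → ℝ, Continuous F → Continuous fun s => ∫ τ in (0 : ℝ)..s, F (s - τ) := by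
    intro F hF
    simp only [intervalIntegral.integral_comp_sub_left, sub_self, sub_zero]
    exact intervalIntegral.continuous_primitive (fun a b => hF.intervalIntegrable a b) 0
  have hmin : ∀ s ∈ Icc 0 t, Imin A b vmin vmax s =
      vmin - ∫ τ in (0 : ℝ)..s, max (k (s - τ) * vmin) (k (s - τ) * vmax) := fun s hs =>
    (hglb s hs).csInf_eq (hne s)
  have hmax : ∀ s ∈ Icc 0 t, Imax A b vmin vmax s =
      vmax + ∫ τ in (0 : ℝ)..s, max (k (s - τ) * -vmax) (k (s - τ) * -vmin) := fun s hs =>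
    (hlub s hs).csSup_eq (hne s)
  have hfree := (continuous_dotProduct_exp (Acon A b) (cvec A) (Mmat A b *ᵥ z₀)).neg
  refine ⟨?_, ?_, fun s hs => ?_⟩
  · refine hfree.continuousOn.add (ContinuousOn.congr (Continuous.continuousOn ?_) hmin)
    exact continuous_const.sub
      (hprim (fun r => max (k r * vmin) (k r * vmax)) (by fun_prop))
  · refine hfree.continuousOn.add (ContinuousOn.congr (Continuous.continuousOn ?_) hmax)
    exact continuous_const.add
      (hprim (fun r => max (k r * -vmax) (k r * -vmin)) (by fun_prop))
  · obtain ⟨y, hy⟩ := hne s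
    refine add_le_add le_rfl ?_
    rw [hmin s hs, hmax s hs]
    exact ((hglb s hs).1 hy).trans ((hlub s hs).1 hy)

end InducedRange

/-! ### Dependence on the range over [0,t] only -/

section Congruence

variable {m : ℕ} {t : ℝ} {x₀ : Fin (m + 1) → ℝ} {umin umax vmin vmax : ℝ → ℝ}

theorem reachSet_congr (hmin : EqOn umin vmin (Icc 0 t)) (hmax : EqOn umax vmax (Icc 0 t)) :
    reachSet t x₀ umin umax = reachSet t x₀ vmin vmax := by
  have h : ∀ u : ℝ → ℝ, (∀ s ∈ Icc 0 t, u s ∈ Icc (umin s) (umax s)) ↔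
      ∀ s ∈ Icc 0 t, u s ∈ Icc (vmin s) (vmax s) := fun u =>
    forall₂_congr fun s hs => by rw [hmin hs, hmax hs]
  simp only [reachSet, h]

theorem contReachSet_congr (hmin : EqOn umin vmin (Icc 0 t)) (hmax : EqOn umax vmax (Icc 0 t)) :
    contReachSet t x₀ umin umax = contReachSet t x₀ vmin vmax := by
  have h : ∀ u : ℝ → ℝ, (∀ s ∈ Icc 0 t, u s ∈ Icc (umin s) (umax s)) ↔
      ∀ s ∈ Icc 0 t, u s ∈ Icc (vmin s) (vmax s) := fun u =>
    forall₂_congr fun s hs => by rw [hmin hs, hmax hs]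
  simp only [contReachSet, h]

theorem eta_congr (ht : 0 ≤ t) (hmin : EqOn umin vmin (Icc 0 t))
    (hmax : EqOn umax vmax (Icc 0 t)) : eta t x₀ umin umax = eta t x₀ vmin vmax := by
  unfold eta
  congr 1
  refine intervalIntegral.integral_congr fun s hs => ?_
  rw [uIcc_of_le ht] at hs
  simp only [nu, hmin hs, hmax hs]

theorem alternating_congr (ht : 0 ≤ t) (hmin : EqOn umin vmin (Icc 0 t))
    (hmax : EqOn umax vmax (Icc 0 t)) {σ : Fin m → ℝ} (hσ : σ ∈ weyl m t) :
    alternating t umin umax σ = alternating t vmin vmax σ := by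
  unfold alternating
  refine Finset.sum_congr rfl fun k _ => ?_
  congr 1
  refine intervalIntegral.integral_congr fun s hs => ?_
  have hs' := uIcc_subset_Icc (nodes_mem_Icc ht hσ _) (nodes_mem_Icc ht hσ _) hs
  simp only [mu, hmin hs', hmax hs']

theorem piMap_congr (ht : 0 ≤ t) (hmin : EqOn umin vmin (Icc 0 t))
    (hmax : EqOn umax vmax (Icc 0 t)) :
    EqOn (piMap t x₀ umin umax) (piMap t x₀ vmin vmax) (weyl m t ×ˢ Icc (0 : ℝ) 1) := by
  rintro ⟨σ, r⟩ ⟨hσ, -⟩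
  rw [piMap_eq, piMap_eq, eta_congr ht hmin hmax, alternating_congr ht hmin hmax hσ]

/-- Constant extension beyond both endpoints keeps continuity and order, which supplies the globally
continuous bounds assumed above. -/
theorem IsContinuousRange.exists_continuous (ht : 0 ≤ t) (h : IsContinuousRange t umin umax) :
    ∃ vmin vmax : ℝ → ℝ, Continuous vmin ∧ Continuous vmax ∧ (∀ s, vmin s ≤ vmax s) ∧
      EqOn umin vmin (Icc 0 t) ∧ EqOn umax vmax (Icc 0 t) := by
  obtain ⟨hmin, hmax, hle⟩ := h
  refine ⟨fun s => umin (projIcc 0 t ht s), fun s => umax (projIcc 0 t ht s), ?_, ?_,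
    fun s => hle _ (projIcc 0 t ht s).2, fun s hs => ?_, fun s hs => ?_⟩
  · exact hmin.comp_continuous (continuous_subtype_val.comp continuous_projIcc)
      fun s => (projIcc 0 t ht s).2
  · exact hmax.comp_continuous (continuous_subtype_val.comp continuous_projIcc)
      fun s => (projIcc 0 t ht s).2
  · simp only [projIcc_of_mem ht hs]
  · simp only [projIcc_of_mem ht hs]

end Congruence

end LTIReach

theorem theorem3 (m : ℕ) (t : ℝ) (ht : 0 < t) (x₀ : Fin (m + 1) → ℝ) (umin umax : ℝ → ℝ)
    (hrange : LTIReach.IsInducedByLTI x₀ umin umax ∨ LTIReach.IsContinuousRange t umin umax) :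
    -- the map `π` takes its values in the reach set and is onto it
    Set.MapsTo (LTIReach.piMap t x₀ umin umax) (LTIReach.weyl m t ×ˢ Set.Icc (0 : ℝ) 1)
      (LTIReach.reachSet t x₀ umin umax) ∧
    Set.SurjOn (LTIReach.piMap t x₀ umin umax) (LTIReach.weyl m t ×ˢ Set.Icc (0 : ℝ) 1)
      (LTIReach.reachSet t x₀ umin umax) ∧
    -- the same for continuous inputs, up to closure
    (∀ x ∈ LTIReach.contReachSet t x₀ umin umax, ∃ σ ∈ LTIReach.weyl m t,
      ∃ r ∈ Set.Icc (0 : ℝ) 1, x = r • LTIReach.xUpper t x₀ umin umax σ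
        + (1 - r) • LTIReach.xLower t x₀ umin umax σ) ∧
    LTIReach.piMap t x₀ umin umax '' (LTIReach.weyl m t ×ˢ Set.Icc (0 : ℝ) 1)
      = closure (LTIReach.contReachSet t x₀ umin umax) ∧
    -- `x^upper(σ)` and `x^lower(σ)` are boundary points, antipodal about the center
    ∀ σ ∈ LTIReach.weyl m t,
      LTIReach.xUpper t x₀ umin umax σ ∈ frontier (LTIReach.reachSet t x₀ umin umax) ∧
      LTIReach.xLower t x₀ umin umax σ ∈ frontier (LTIReach.reachSet t x₀ umin umax) ∧
      LTIReach.xUpper t x₀ umin umax σ ∈ frontier (LTIReach.contReachSet t x₀ umin umax) ∧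
      LTIReach.xLower t x₀ umin umax σ ∈ frontier (LTIReach.contReachSet t x₀ umin umax) ∧
      LTIReach.xLower t x₀ umin umax σ - LTIReach.eta t x₀ umin umax
        = -(LTIReach.xUpper t x₀ umin umax σ - LTIReach.eta t x₀ umin umax) := by
  have hr : LTIReach.IsContinuousRange t umin umax :=
    hrange.elim (fun h => h.isContinuousRange t) id
  obtain ⟨vmin, vmax, hvmin, hvmax, hle, hmin, hmax⟩ := hr.exists_continuous ht.le
  have hpi := LTIReach.piMap_congr (x₀ := x₀) ht.le hmin hmax
  have hmaps := LTIReach.mapsTo_piMap (x₀ := x₀) ht.le hvmin hvmax hle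
  have hsurj := LTIReach.surjOn_piMap (x₀ := x₀) ht.le hvmin hvmax hle
  rw [LTIReach.reachSet_congr hmin hmax, LTIReach.contReachSet_congr hmin hmax]
  refine ⟨hmaps.congr hpi.symm, hsurj.congr hpi.symm, fun x hx => ?_, ?_, fun σ hσ => ?_⟩
  · obtain ⟨⟨σ, r⟩, ⟨hσ, hr⟩, rfl⟩ :=
      (hsurj.congr hpi.symm) (LTIReach.contReachSet_subset_reachSet ht.le hx)
    exact ⟨σ, hσ, r, hr, rfl⟩
  · rw [hpi.image_eq, LTIReach.image_piMap_eq_closure ht.le hvmin hvmax hle]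
  · have hu := LTIReach.mem_frontier_of_switching (x₀ := x₀) ht.le hvmin hvmax hle hσ (Or.inl rfl)
    have hl := LTIReach.mem_frontier_of_switching (x₀ := x₀) ht.le hvmin hvmax hle hσ (Or.inr rfl)
    rw [one_smul] at hu
    rw [neg_one_smul, ← sub_eq_add_neg] at hl
    rw [LTIReach.xUpper, LTIReach.xLower, LTIReach.eta_congr ht.le hmin hmax,
      LTIReach.alternating_congr ht.le hmin hmax hσ]
    exact ⟨hu.1, hl.1, hu.2, hl.2, by abel⟩
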